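/- Let relations be finite multisets of tuples over a finite set of attributes $A_1,\dots,A_n$, where each attribute $A_i$ has a finite set of non-null domain values with at least two elements, and where tuples may also contain the null symbol $*$. A grounding of a relation $r$ is a relation obtained by replacing, independently in every copy of every tuple, each null symbol by some non-null value of the respective domain. For sets of attributes $X,Y$, a relation $r$ satisfies the independence atom $X\perp Y$ if no tuple of $r$ has a null in an attribute of $X\cup Y$ and for all $t_1,t_2\in r$ there is $t\in r$ with $t(X)=t_1(X)$ and $t(Y)=t_2(Y)$; it satisfies the possible independence atom $X\perp_p Y$ if some grounding of $r$ satisfies $X\perp Y$. The atom $X\perp_p Y$ is unary if $|X|=|Y|=1$ (the case $X=Y$ is allowed). Theorem. Model checking of unary possible independence atoms is in polynomial time, both in data complexity and in combined complexity: 1. (Data complexity.) For every fixed unary atom $\sigma = A\perp_p B$, the problem of deciding, given a relation $r$ over attributes including $A$ and $B$ together with the finite domains of its attributes, whether $r\models\sigma$, is decidable in polynomial time. 2. (Combined complexity.) The problem of deciding, given a relation $r$ together with its attributes and their finite domains, and a unary atom $\sigma = A\perp_p B$ over these attributes, whether $r\models\sigma$, is decidable in polynomial time. Both statements hold when the multiplicities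 of the tuples are written in unary, and also when they are written in binary. -/

import Mathlib

namespace PossibleIndependence

open Computability

/-! ### Relations with nulls, groundings, independence -/

/-- A relation schema: a finite set of attributes, each with a finite set `dom A` of non-null
values containing at least two elements. The null symbol is `none : Option Val`, so that the full
domain of `A` is `none` together with all `some v`, `v ∈ dom A`. (The values of `dom` outside
`attrs` play no role.) -/
structure Schema (Att Val : Type*) where
  attrs : Finset Att
  dom : Att → Finset Val
  two_le_card_dom : ∀ A ∈ attrs, 2 ≤ (dom A).card

variable {Att Val : Type*}

/-- Assignments of a value or null to the attributes of `R`, before domains are taken into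
account. -/
abbrev Schema.Row (R : Schema Att Val) : Type _ := R.attrs → Option Val

/-- `t` is a tuple over `R`: all its non-null entries lie in the respective domains. -/
def Schema.IsTuple (R : Schema Att Val) (t : R.Row) : Prop :=
  ∀ (A : R.attrs) (v : Val), t A = some v → v ∈ R.dom A

/-- A relation over `R`: a finite multiset of tuples over `R`. -/
structure Relation (R : Schema Att Val) where
  tuples : Multiset R.Row
  isTuple : ∀ t ∈ tuples, R.IsTuple t

/-- `t'` is a grounding of the tuple `t`: a complete tuple over `R` obtained from `t` by replacing
its nulls with non-null values of the respective domains. -/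
def Schema.IsTupleGrounding (R : Schema Att Val) (t t' : R.Row) : Prop :=
  R.IsTuple t' ∧ (∀ A, t' A ≠ none) ∧ ∀ A, t A ≠ none → t' A = t A

/-- `r'` is a grounding of `r`: every copy of every tuple of `r` is replaced, independently of the
others, by one of its groundings. -/
def Relation.IsGrounding {R : Schema Att Val} (r r' : Relation R) : Prop :=
  Multiset.Rel R.IsTupleGrounding r.tuples r'.tuples

/-- The independence atom `X ⊥ Y`. -/
def Relation.Indep {R : Schema Att Val} (r : Relation R) (X Y : Finset Att) : Prop :=
  (∀ t ∈ r.tuples, ∀ A : R.attrs, (A : Att) ∈ X ∨ (A : Att) ∈ Y → t A ≠ none) ∧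
  ∀ t₁ ∈ r.tuples, ∀ t₂ ∈ r.tuples, ∃ t ∈ r.tuples,
    (∀ A : R.attrs, (A : Att) ∈ X → t A = t₁ A) ∧ (∀ A : R.attrs, (A : Att) ∈ Y → t A = t₂ A)

/-- A possible independence atom `X ⊥ₚ Y`, as a syntactic object. -/
structure PIA (Att : Type*) where
  X : Finset Att
  Y : Finset Att

/-- `σ` is an atom over the schema `R`. -/
def PIA.Over (σ : PIA Att) (R : Schema Att Val) : Prop :=
  σ.X ⊆ R.attrs ∧ σ.Y ⊆ R.attrs

/-- `r ⊨ X ⊥ₚ Y`: some grounding of `r` satisfies `X ⊥ Y`. -/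
def Relation.Satisfies {R : Schema Att Val} (r : Relation R) (σ : PIA Att) : Prop :=
  ∃ r' : Relation R, r.IsGrounding r' ∧ r'.Indep σ.X σ.Y

/-! ### Inputs of the model checking problems -/

/-- A listing of a relation together with its schema. Attributes and values are represented by
natural numbers. A column is an attribute together with a list of its non-null domain values; a row
is the list of its cells, in the order of the columns, together with its multiplicity. The columns,
the values and the rows may be listed in any order; when a row is repeated, its multiplicities
add up. -/
structure Table where
  cols : List (ℕ × List ℕ)
  rows : List (List (Option ℕ) × ℕ)
  nodup : (cols.map Prod.fst).Nodup
  two_le_card : ∀ c ∈ cols, 2 ≤ c.2.toFinset.card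
  cell_mem : ∀ w ∈ rows, List.Forall₂ (fun cell c => ∀ v, cell = some v → v ∈ c.2) w.1 cols
  mult_pos : ∀ w ∈ rows, 0 < w.2

namespace Table

/-- The schema described by a table. -/
def schema (T : Table) : Schema ℕ ℕ where
  attrs := (T.cols.map Prod.fst).toFinset
  dom A := ((T.cols.map Prod.snd).getD ((T.cols.map Prod.fst).idxOf A) []).toFinset
  two_le_card_dom A hA := by
    have h : (T.cols.map Prod.fst).idxOf A < T.cols.length := by
      simpa using List.idxOf_lt_length_of_mem (List.mem_toFinset.1 hA)
    simpa [List.getD_eq_getElem, h] using T.two_le_card _ (List.getElem_mem h)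

/-- The entry of the row `w` of the table in the column of the attribute `A`. -/
def entry (T : Table) (w : List (Option ℕ)) : T.schema.Row :=
  fun A => w.getD ((T.cols.map Prod.fst).idxOf (A : ℕ)) none

/-- The relation described by a table. -/
def relation (T : Table) : Relation T.schema where
  tuples := ↑(T.rows.flatMap fun w => List.replicate w.2 (T.entry w.1))
  isTuple t ht A v hv := by
    obtain ⟨w, hw, hts⟩ := List.mem_flatMap.1 (Multiset.mem_coe.1 ht)
    rw [List.eq_of_mem_replicate hts] at hv
    have h : (T.cols.map Prod.fst).idxOf (A : ℕ) < T.cols.length := by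
      simpa using List.idxOf_lt_length_of_mem (List.mem_toFinset.1 A.2)
    have hc := T.cell_mem w hw
    have h' : (T.cols.map Prod.fst).idxOf (A : ℕ) < w.1.length := by rwa [hc.length_eq]
    have hv' : w.1[(T.cols.map Prod.fst).idxOf (A : ℕ)] = some v := by
      simpa [entry, List.getD_eq_getElem, h'] using hv
    simpa [schema, List.getD_eq_getElem, h] using hc.get h' h v hv'

end Table

/-! ### Encoding of the inputs as strings over a finite alphabet

The alphabet `Γ'` consists of a blank, the two bits, a comma and two brackets. -/

/-- The two ways of writing the multiplicities of tuples. -/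
inductive MultiplicityCoding
  | unary
  | binary

/-- A multiplicity is written in unary or in binary and closed by a comma. -/
def MultiplicityCoding.encode : MultiplicityCoding → ℕ → List Γ'
  | .unary, m => (unaryEncodeNat m).map Γ'.bit ++ [Γ'.comma]
  | .binary, m => (encodeNat m).map Γ'.bit ++ [Γ'.comma]

/-- Names of attributes and values are written in binary and closed by a comma. -/
def encodeName (n : ℕ) : List Γ' := (encodeNat n).map Γ'.bit ++ [Γ'.comma]

/-- A null is written as a blank. -/
def encodeCell : Option ℕ → List Γ'
  | none => [Γ'.blank]
  | some v => encodeName v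

/-- A list is written as the concatenation of its entries, enclosed in brackets. -/
def encodeListWith {α : Type*} (e : α → List Γ') (l : List α) : List Γ' :=
  Γ'.bra :: (l.flatMap e ++ [Γ'.ket])

/-- The string of a table: the list of its columns (with attributes and domains), followed by the
list of its rows (with cells and multiplicities). -/
def Table.encode (μ : MultiplicityCoding) (T : Table) : List Γ' :=
  encodeListWith (fun c => encodeName c.1 ++ encodeListWith encodeName c.2) T.cols ++
  encodeListWith (fun w => encodeListWith encodeCell w.1 ++ μ.encode w.2) T.rows

/-- The string of an atom. -/
def PIA.encode (σ : PIA ℕ) : List Γ' :=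
  encodeListWith encodeName (σ.X.sort (· ≤ ·)) ++ encodeListWith encodeName (σ.Y.sort (· ≤ ·))

/-! ### The decision problems and polynomial time -/

open Classical in
/-- The decision problem `p` on the inputs in `α`, presented by the strings `e a`, is in polynomial
time: some Turing machine outputs, for every input `a`, the truth value of `p a` within a number of
steps polynomial in the length of `e a`. -/
def InPolyTime {α : Type} (e : α → List Γ') (p : α → Prop) : Prop :=
  Nonempty (Turing.TM2ComputableInPolyTime e encodeBool fun a => decide (p a))

/-- The inputs of the combined complexity problem for a class `P` of atoms. -/
def CombinedInput (P : Set (PIA ℕ)) : Type :=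
  {I : Table × PIA ℕ // I.2 ∈ P ∧ I.2.Over I.1.schema}

/-- The combined complexity problem for `P` is in polynomial time. -/
def CombinedComplexityInPolyTime (μ : MultiplicityCoding) (P : Set (PIA ℕ)) : Prop :=
  InPolyTime (α := CombinedInput P) (fun I => I.1.1.encode μ ++ I.1.2.encode)
    (fun I => I.1.1.relation.Satisfies I.1.2)

/-- The inputs of the data complexity problem of the fixed atom `σ`. -/
def DataInput (σ : PIA ℕ) : Type :=
  {T : Table // σ.Over T.schema}

/-- The data complexity problem for `P` is in polynomial time: it is so for each atom in `P`. -/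
def DataComplexityInPolyTime (μ : MultiplicityCoding) (P : Set (PIA ℕ)) : Prop :=
  ∀ σ ∈ P, InPolyTime (α := DataInput σ) (fun T => T.1.encode μ)
    (fun T => T.1.relation.Satisfies σ)

/-- The class of unary possible independence atoms: both sides are single attributes. -/
def unaryPIAs : Set (PIA ℕ) :=
  {σ | σ.X.card = 1 ∧ σ.Y.card = 1}

end PossibleIndependence

/-! Combinatorics. Let `A ≠ B`, and let `SA`, `SB` be the sets of non-null values occurring in the
two columns, where a column consisting of nulls only contributes a single placeholder. A grounding
satisfying independence realises a full rectangle of pairs containing these values; retracting all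
other values into `SA` and `SB` shows that the tuples can be completed so as to hit every pair of
`SA ×ˢ SB`. This yields Hall's condition for matching each pair with its own copy of a tuple
compatible with it (`hallCondition_of_satisfies`). Conversely, Hall's theorem gives such a matching,
the unmatched copies are completed to any compatible pair inside the rectangle, and the realised
pairs are then exactly the rectangle (`exists_completion`, `satisfies_of_hallCondition`). For `A =
B` the atom says that the column is constant, which is possible iff at most one non-null value
occurs (`satisfies_self_iff`). Of the domains only their non-emptiness matters.

Multiplicities. Hall's condition compares counts of tuples with numbers up to `|SA ×ˢ SB|`, which is
polynomial in the number of listed rows. So multiplicities can be truncated at this number, and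
binary notation causes no blow-up (`cap_bits`, `le_countP_flatMap_replicate_min`).

Matching. Hall's condition is decided by an auction: a waiting pair buys a cheapest compatible
tuple, raises its price by one and evicts the owner. Prices are bounded by the number of pairs, so
the auction stops soon; if a pair is left waiting, a vacant price level exhibits a violation of
Hall's condition (`auction_eq_nil_iff`).

Complexity. A small while language on string registers is compiled step by step into stack machines
(`steps_of_exec`). On top of it, `PolyFun` is closed under composition, pairing, case distinction
and folds whose intermediate results stay polynomially small (`PolyFun.foldl`,
`PolyFun.foldl_of_le`). Parser, auction and decision procedure are assembled from these closure
properties. -/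

namespace PossibleIndependence

open Computability Function

/-! ### A while language over stack registers -/

/-- Programs over registers indexed by natural numbers, each holding a string over `Γ'`. Tests only
see the top symbol of a register. -/
inductive Prog
  | skip
  | push (r : ℕ) (a : Γ')
  | pop (r : ℕ)
  | seq (p q : Prog)
  | ite (r : ℕ) (c : Option Γ' → Bool) (p q : Prog)
  | loop (r : ℕ) (c : Option Γ' → Bool) (p : Prog)

/-- The contents of all registers. -/
abbrev Store := ℕ → List Γ'

/-- `Exec p s t s'`: started in `s`, the program `p` ends in `s'` after `t` steps. -/
inductive Exec : Prog → Store → ℕ → Store → Prop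
  | skip (s) : Exec .skip s 1 s
  | push (r a s) : Exec (.push r a) s 1 (update s r (a :: s r))
  | pop (r s) : Exec (.pop r) s 1 (update s r (s r).tail)
  | seq {p q s t s' t' s''} : Exec p s t s' → Exec q s' t' s'' → Exec (.seq p q) s (t + t') s''
  | ite_true {r c p q s t s'} : c (s r).head? = true → Exec p s t s' →
      Exec (.ite r c p q) s (1 + t) s'
  | ite_false {r c p q s t s'} : c (s r).head? = false → Exec q s t s' →
      Exec (.ite r c p q) s (1 + t) s'
  | loop_true {r c p s t s' t' s''} : c (s r).head? = true → Exec p s t s' →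
      Exec (.loop r c p) s' t' s'' → Exec (.loop r c p) s (1 + t + t') s''
  | loop_false {r c p s} : c (s r).head? = false → Exec (.loop r c p) s 1 s

/-- One step pushes at most one symbol. Time bounds therefore bound the size of outputs. -/
theorem Exec.length_le {p : Prog} {s s' : Store} {t : ℕ} (h : Exec p s t s') (i : ℕ) :
    (s' i).length ≤ (s i).length + t := by
  induction h with
  | skip | loop_false => omega
  | push r a s | pop r s => by_cases hi : i = r <;> simp [hi] <;> omega
  | seq | ite_true | ite_false | loop_true => omega

/-! ### Compilation of programs to stack machines -/

namespace Prog

/-- All registers used by the program are below `N`. -/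
def Below (N : ℕ) : Prog → Prop
  | skip => True
  | push r _ | pop r => r < N
  | seq p q => p.Below N ∧ q.Below N
  | ite r _ p q => r < N ∧ p.Below N ∧ q.Below N
  | loop r _ p => r < N ∧ p.Below N

theorem Below.mono {N N' : ℕ} (hN : N ≤ N') {p : Prog} (h : p.Below N) : p.Below N' := by
  induction p with simp only [Below] at h ⊢
  | push | pop => omega
  | seq p q hp hq => exact ⟨hp h.1, hq h.2⟩
  | ite r c p q hp hq => exact ⟨by omega, hp h.2.1, hq h.2.2⟩
  | loop r c p hp => exact ⟨by omega, hp h.2⟩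

theorem exists_below (p : Prog) : ∃ N, p.Below N := by
  induction p with
  | skip => exact ⟨0, trivial⟩
  | push r | pop r => exact ⟨r + 1, Nat.lt_succ_self r⟩
  | seq p q hp hq =>
    obtain ⟨N, hN⟩ := hp
    obtain ⟨M, hM⟩ := hq
    exact ⟨max N M, hN.mono (le_max_left _ _), hM.mono (le_max_right _ _)⟩
  | ite r c p q hp hq =>
    obtain ⟨N, hN⟩ := hp
    obtain ⟨M, hM⟩ := hq
    exact ⟨max (r + 1) (max N M), by omega, hN.mono (by omega), hM.mono (by omega)⟩
  | loop r c p hp =>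
    obtain ⟨N, hN⟩ := hp
    exact ⟨max (r + 1) N, by omega, hN.mono (by omega)⟩

/-- The control points of a program. -/
def Label : Prog → Type
  | skip | push _ _ | pop _ => Unit
  | seq p q => p.Label ⊕ q.Label
  | ite _ _ p q => Option (p.Label ⊕ q.Label)
  | loop _ _ p => Option p.Label

instance Label.fintype : (p : Prog) → Fintype p.Label
  | skip | push _ _ | pop _ => inferInstanceAs (Fintype Unit)
  | seq p q => @instFintypeSum _ _ (Label.fintype p) (Label.fintype q)
  | ite _ _ p q =>
    @instFintypeOption _ (@instFintypeSum _ _ (Label.fintype p) (Label.fintype q))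
  | loop _ _ p => @instFintypeOption _ (Label.fintype p)

/-- The control point where the execution of a program starts. -/
def entry : (p : Prog) → p.Label
  | skip | push _ _ | pop _ => ()
  | seq p _ => Sum.inl p.entry
  | ite _ _ _ _ | loop _ _ _ => none

/-- The alphabets of the memory: the output stack `none` holds bits. -/
abbrev StackSymbol {N : ℕ} : Option (Fin N) → Type
  | none => Bool
  | some _ => Γ'

/-- Statements of the compiled machine. -/
abbrev MStmt (N : ℕ) (Λ : Type) := Turing.TM2.Stmt (StackSymbol (N := N)) Λ (Option Γ')

variable {N : ℕ} [NeZero N] {Λ : Type}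

/-- The stack holding a register. -/
abbrev stackOf (N : ℕ) [NeZero N] (r : ℕ) : Option (Fin N) := some (Fin.ofNat N r)

/-- Continue at a label, with the local variable cleared. -/
def jump (l : Λ) : MStmt N Λ := .load (fun _ => none) (.goto fun _ => l)

/-- Branch on the top symbol of a register. -/
def test (r : ℕ) (c : Option Γ' → Bool) (l l' : Λ) : MStmt N Λ :=
  .peek (stackOf N r) (fun _ o => o) (.branch c (jump l) (jump l'))

/-- The statement at each control point, where `emb` embeds the control points in the labels of the
machine and `exit` is the label at which to continue. -/
def code : (p : Prog) → (p.Label → Λ) → Λ → p.Label → MStmt N Λ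
  | skip, _, exit, _ => jump exit
  | push r a, _, exit, _ => .push (stackOf N r) (fun _ => a) (jump exit)
  | pop r, _, exit, _ => .pop (stackOf N r) (fun v _ => v) (jump exit)
  | seq p q, emb, exit, l =>
    match l with
    | .inl l => p.code (fun x => emb (.inl x)) (emb (.inr q.entry)) l
    | .inr l => q.code (fun x => emb (.inr x)) exit l
  | ite r c p q, emb, exit, l =>
    match l with
    | none => test r c (emb (some (.inl p.entry))) (emb (some (.inr q.entry)))
    | some (.inl l) => p.code (fun x => emb (some (.inl x))) exit l
    | some (.inr l) => q.code (fun x => emb (some (.inr x))) exit l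
  | loop r c p, emb, exit, l =>
    match l with
    | none => test r c (emb (some p.entry)) exit
    | some l => p.code (fun x => emb (some x)) (emb none) l

/-- The memory of the machine when the registers hold `s`. -/
def memory (N : ℕ) (s : Store) : (k : Option (Fin N)) → List (StackSymbol k)
  | none => ([] : List Bool)
  | some i => s i

theorem memory_stackOf (s : Store) {r : ℕ} (hr : r < N) :
    memory N s (stackOf N r) = s r := by
  simp [memory, stackOf, Fin.ofNat, Nat.mod_eq_of_lt hr]

theorem memory_update (s : Store) {r : ℕ} (hr : r < N) (x : List Γ') :
    memory N (update s r x) = update (memory N s) (stackOf N r) x := by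
  funext k
  cases k with
  | none => simp [stackOf, memory]
  | some i =>
    by_cases h : i = Fin.ofNat N r
    · subst h
      simp [stackOf, memory, Nat.mod_eq_of_lt hr]
    · rw [update_of_ne (by simpa [stackOf] using h)]
      have : (i : ℕ) ≠ r := fun e => h (by ext; simp [← e])
      simp [memory, update_of_ne this]

/-- The configuration at a label, when the registers hold `s`. -/
def cfg (N : ℕ) (l : Λ) (s : Store) : Turing.TM2.Cfg (StackSymbol (N := N)) Λ (Option Γ') :=
  ⟨some l, none, memory N s⟩

/-- `Steps M t a b`: the machine `M` goes from `a` to `b` in `t` steps. -/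
def Steps (M : Λ → MStmt N Λ) (t : ℕ) (a b : Turing.TM2.Cfg (StackSymbol (N := N)) Λ (Option Γ')) :
    Prop :=
  (flip bind (Turing.TM2.step M))^[t] (some a) = some b

omit [NeZero N] in
theorem Steps.trans {M : Λ → MStmt N Λ} {t t' a b c} (h : Steps M t a b) (h' : Steps M t' b c) :
    Steps M (t + t') a c := by
  unfold Steps at *
  rw [add_comm, iterate_add_apply, h, h']

theorem Steps.test {M : Λ → MStmt N Λ} {l₀ l l' : Λ} {r : ℕ} {c : Option Γ' → Bool} (hr : r < N)
    (h : M l₀ = Prog.test r c l l') (s : Store) :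
    Steps M 1 (cfg N l₀ s) (cfg N (if c (s r).head? then l else l') s) := by
  have e := memory_stackOf s hr
  simp only [Steps, cfg, iterate_one, flip, Option.bind_eq_bind, Option.bind_some,
    Turing.TM2.step.eq_2, h, Prog.test, jump, Turing.TM2.stepAux]
  rw [e]
  cases c (s r).head? <;> simp

/-- Every instruction and every test is one machine step, so the step counts agree exactly. Machine,
embedding and exit are arbitrary because a subprogram sits inside a larger machine: the exit of the
first part of a sequence is the entry of the second, and the exit of a loop body is the head of the
loop. Since `jump` clears the local variable, the configuration at a label depends only on the
registers. -/
theorem steps_of_exec {p : Prog} {s s' : Store} {t : ℕ} (h : Exec p s t s') :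
    ∀ {Λ : Type} {M : Λ → MStmt N Λ} {emb : p.Label → Λ} {exit : Λ},
      (∀ l, M (emb l) = p.code emb exit l) → p.Below N →
      Steps M t (cfg N (emb p.entry) s) (cfg N exit s') := by
  induction h with
  | skip s =>
    intro Λ M emb exit hM _
    simp [Steps, cfg, flip, hM, code, jump]
  | push r a s =>
    intro Λ M emb exit hM hr
    have e := memory_stackOf s hr
    simp only [Steps, cfg, iterate_one, flip, Option.bind_eq_bind, Option.bind_some,
      Turing.TM2.step.eq_2, hM, code, jump, Turing.TM2.stepAux, memory_update s hr]
    rw [e]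
  | pop r s =>
    intro Λ M emb exit hM hr
    have e := memory_stackOf s hr
    simp only [Steps, cfg, iterate_one, flip, Option.bind_eq_bind, Option.bind_some,
      Turing.TM2.step.eq_2, hM, code, jump, Turing.TM2.stepAux, memory_update s hr]
    rw [e]
  | seq _ _ ih ih' =>
    intro Λ M emb exit hM hN
    exact (ih (emb := fun x => emb (.inl x)) (fun l => hM (.inl l)) hN.1).trans
      (ih' (emb := fun x => emb (.inr x)) (fun l => hM (.inr l)) hN.2)
  | ite_true hc _ ih =>
    intro Λ M emb exit hM hN
    have h1 := Steps.test hN.1 (hM none)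
    refine (h1 _).trans ?_
    rw [if_pos hc]
    exact ih (emb := fun x => emb (some (.inl x))) (fun l => hM (some (.inl l))) hN.2.1
  | ite_false hc _ ih =>
    intro Λ M emb exit hM hN
    have h1 := Steps.test hN.1 (hM none)
    refine (h1 _).trans ?_
    rw [if_neg (by simp [hc])]
    exact ih (emb := fun x => emb (some (.inr x))) (fun l => hM (some (.inr l))) hN.2.2
  | loop_true hc _ _ ih ih' =>
    intro Λ M emb exit hM hN
    have h1 := Steps.test hN.1 (hM none)
    refine ((h1 _).trans ?_).trans (ih' hM hN)
    rw [if_pos hc]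
    exact ih (emb := fun x => emb (some x)) (fun l => hM (some l)) hN.2
  | @loop_false r c p s hc =>
    intro Λ M emb exit hM hN
    have h1 := Steps.test hN.1 (hM none) s
    rwa [if_neg (by simp [hc])] at h1

/-- Move the bit in register `0` to the output stack and halt. -/
def outputStmt : MStmt N Λ :=
  .pop (stackOf N 0) (fun _ o => o)
    (.push none (fun v => (decide (v = some (Γ'.bit true)) : Bool)) (.load (fun _ => none) .halt))

/-- The machine that runs `p` and outputs the bit in register `0`. -/
def machine (N : ℕ) [NeZero N] (p : Prog) : Turing.FinTM2 where
  K := Option (Fin N)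
  k₀ := stackOf N 0
  k₁ := none
  Γ := StackSymbol
  Λ := Option p.Label
  main := some p.entry
  σ := Option Γ'
  initialState := none
  Γk₀Fin := inferInstanceAs (Fintype Γ')
  m
    | none => outputStmt
    | some l => p.code some none l

end Prog

-- The halting configuration has all stacks empty but the output stack; hence the final store is
-- prescribed on every register. Transferring the answer bit costs the extra step in `T + 1`.
open Prog in
theorem inPolyTime_of_exec {α : Type} {e : α → List Γ'} {P : α → Prop} (p : Prog)
    (T : Polynomial ℕ)
    (h : ∀ a (b : Bool), (b = true ↔ P a) → ∃ t ≤ T.eval (e a).length,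
      Exec p (update (fun _ => []) 0 (e a)) t (update (fun _ => []) 0 [Γ'.bit b])) :
    InPolyTime e P := by
  classical
  obtain ⟨N, hN⟩ := p.exists_below
  -- The machine needs at least one register, hence `N + 1`.
  have hN := hN.mono (Nat.le_succ N)
  refine ⟨⟨⟨machine (N + 1) p, Equiv.refl Γ', Equiv.refl Bool⟩, T + 1, fun a => ?_⟩⟩
  have key : ∃ t ≤ (T + 1).eval (e a).length,
      Steps (machine (N + 1) p).m t
        (Turing.initList (machine (N + 1) p) (e a))
        (Turing.haltList (machine (N + 1) p) (encodeBool (decide (P a)))) := by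
    obtain ⟨t, ht, hx⟩ := h a (decide (P a)) (by simp)
    refine ⟨t + 1, by simpa using ht, ?_⟩
    have h1 := steps_of_exec (N := N + 1) hx (M := (machine (N + 1) p).m) (emb := some)
      (exit := none) (fun l => rfl) hN
    have h2 : Turing.initList (machine (N + 1) p) (e a) =
        cfg (N + 1) (some p.entry) (update (fun _ => []) 0 (e a)) := by
      refine congrArg (Turing.TM2.Cfg.mk _ _) ?_
      funext k
      rcases k with _ | i
      · rfl
      · by_cases hi : i = 0
        · subst hi
          rfl
        · have : (i : ℕ) ≠ 0 := fun h => hi (Fin.ext h)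
          have hk : (some i : Option (Fin (N + 1))) ≠ stackOf (N + 1) 0 :=
            fun h => hi (Option.some.inj h)
          exact (dif_neg hk).trans (by simp only [memory, update_of_ne this]; rfl)
    rw [h2]
    refine h1.trans ?_
    have e0 := memory_stackOf (N := N + 1) (update (fun _ => []) 0 [Γ'.bit (decide (P a))])
      (Nat.succ_pos N)
    simp only [Steps, cfg, iterate_one, flip, Option.bind_eq_bind, Option.bind_some,
      Turing.TM2.step.eq_2, machine, outputStmt, Turing.TM2.stepAux]
    rw [e0]
    refine congrArg some (congrArg (Turing.TM2.Cfg.mk _ _) ?_)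
    funext k
    cases k with
    | none => 
      simp [encodeBool, memory, stackOf]
    | some i =>
      by_cases hi : i = 0
      · subst hi
        rw [update_of_ne (by simp)]
        exact update_self ..
      · have : (i : ℕ) ≠ 0 := fun h => hi (Fin.ext h)
        simp [stackOf, memory, hi, this]
  refine Classical.choice ?_
  obtain ⟨t, ht, hs⟩ := key
  refine ⟨⟨⟨t, ?_⟩, ht⟩⟩
  have e₁ : (e a).map (Equiv.refl Γ').invFun = e a := List.map_id _
  have e₂ : (encodeBool (decide (P a))).map (Equiv.refl Bool).invFun = encodeBool (decide (P a)) :=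
    List.map_id _
  exact (congrArg₂ (fun x y => (flip bind (Turing.TM2.step (machine (N + 1) p).m))^[t]
    (some (Turing.initList (machine (N + 1) p) x)) =
      some (Turing.haltList (machine (N + 1) p) y)) e₁ e₂).mpr hs

/-! ### Basic programs -/

/-- The program `p` leads from `s` to `s'` in at most `T` steps. -/
def Runs (p : Prog) (s : Store) (T : ℕ) (s' : Store) : Prop := ∃ t ≤ T, Exec p s t s'

namespace Runs

variable {p q : Prog} {s s' s'' : Store} {T T' : ℕ} {r : ℕ} {c : Option Γ' → Bool}

theorem mono (h : Runs p s T s') (hT : T ≤ T') : Runs p s T' s' :=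
  let ⟨t, ht, hx⟩ := h
  ⟨t, ht.trans hT, hx⟩

theorem seq (h : Runs p s T s') (h' : Runs q s' T' s'') : Runs (p.seq q) s (T + T') s'' :=
  let ⟨t, ht, hx⟩ := h
  let ⟨t', ht', hx'⟩ := h'
  ⟨t + t', add_le_add ht ht', hx.seq hx'⟩

theorem skip : Runs .skip s 1 s := ⟨1, le_rfl, .skip s⟩

theorem push {a : Γ'} (h : s' = update s r (a :: s r)) : Runs (.push r a) s 1 s' :=
  ⟨1, le_rfl, h ▸ .push r a s⟩

theorem pop (h : s' = update s r (s r).tail) : Runs (.pop r) s 1 s' :=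
  ⟨1, le_rfl, h ▸ .pop r s⟩

theorem ite_true (hc : c (s r).head? = true) (h : Runs p s T s') :
    Runs (.ite r c p q) s (1 + T) s' :=
  let ⟨t, ht, hx⟩ := h
  ⟨1 + t, by omega, .ite_true hc hx⟩

theorem ite_false (hc : c (s r).head? = false) (h : Runs q s T s') :
    Runs (.ite r c p q) s (1 + T) s' :=
  let ⟨t, ht, hx⟩ := h
  ⟨1 + t, by omega, .ite_false hc hx⟩

theorem loop_true (hc : c (s r).head? = true) (h : Runs p s T s')
    (h' : Runs (.loop r c p) s' T' s'') : Runs (.loop r c p) s (1 + T + T') s'' :=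
  let ⟨t, ht, hx⟩ := h
  let ⟨t', ht', hx'⟩ := h'
  ⟨1 + t + t', by omega, .loop_true hc hx hx'⟩

theorem loop_false (hc : c (s r).head? = false) : Runs (.loop r c p) s 1 s :=
  ⟨1, le_rfl, .loop_false hc⟩

end Runs

namespace Prog

/-- Copy the top symbol of `r` to `q`. -/
def copyTop (r q : ℕ) : Prog :=
  .ite r (· = some (.bit true)) (.push q (.bit true)) <|
  .ite r (· = some (.bit false)) (.push q (.bit false)) <|
  .ite r (· = some .blank) (.push q .blank) <|
  .ite r (· = some .comma) (.push q .comma) <|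
  .ite r (· = some .bra) (.push q .bra) <|
  .push q .ket

/-- Move the content of `r` to `q`, reversing it. -/
def move (r q : ℕ) : Prog := .loop r Option.isSome (.seq (copyTop r q) (.pop r))

/-- Move the content of `r` to `q` and to `q'`, reversing it. -/
def moveBoth (r q q' : ℕ) : Prog :=
  .loop r Option.isSome (.seq (copyTop r q) (.seq (copyTop r q') (.pop r)))

/-- Empty the register `r`. -/
def clear (r : ℕ) : Prog := .loop r Option.isSome (.pop r)

/-- Put a string on top of the register `r`. -/
def write (r : ℕ) : List Γ' → Prog
  | [] => .skip
  | a :: l => .seq (write r l) (.push r a)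

end Prog

namespace Runs

variable {s s' : Store} {r q q' : ℕ}

theorem copyTop {a : Γ'} (h : (s r).head? = some a) (hs' : s' = update s q (a :: s q)) :
    Runs (Prog.copyTop r q) s 6 s' := by
  subst hs'
  unfold Prog.copyTop
  have e {b : Γ'} : ((some a = some b : Bool) = true) ↔ a = b := by simp
  rcases a with _ | (_ | _) | _ | _ | _
  · exact (ite_false (by simp [h]) <| ite_false (by simp [h]) <| ite_true (by simp [h]) <|
      push rfl).mono (by norm_num)
  · exact (ite_false (by simp [h]) <| ite_true (by simp [h]) <| push rfl).mono (by norm_num)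
  · exact (ite_true (by simp [h]) <| push rfl).mono (by norm_num)
  · exact (ite_false (by simp [h]) <| ite_false (by simp [h]) <| ite_false (by simp [h]) <|
      ite_false (by simp [h]) <| ite_true (by simp [h]) <| push rfl).mono (by norm_num)
  · exact (ite_false (by simp [h]) <| ite_false (by simp [h]) <| ite_false (by simp [h]) <|
      ite_false (by simp [h]) <| ite_false (by simp [h]) <| push rfl).mono (by norm_num)
  · exact (ite_false (by simp [h]) <| ite_false (by simp [h]) <| ite_false (by simp [h]) <|
      ite_true (by simp [h]) <| push rfl).mono (by norm_num)

theorem move {l : List Γ'} (hrq : r ≠ q) (hr : s r = l) (h₁ : s' r = [])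
    (h₂ : s' q = l.reverse ++ s q) (h₃ : ∀ i, i ≠ r → i ≠ q → s' i = s i) :
    Runs (Prog.move r q) s (8 * l.length + 1) s' := by
  induction l generalizing s with
  | nil =>
    have : s' = s := by
      funext i
      by_cases hi : i = r
      · rw [hi, h₁, hr]
      · by_cases hi' : i = q
        · rw [hi', h₂]; rfl
        · exact h₃ i hi hi'
    subst this
    exact loop_false (by simp [hr])
  | cons a l ih =>
    have := ih (s := update (update s q (a :: s q)) r l) (by simp) (by simp [hrq.symm, h₂])
      (fun i hi hi' => by simp [hi, hi', h₃])
    refine (loop_true (by simp [hr]) (seq (copyTop (by simp [hr]; rfl) rfl) (pop ?_)) this).mono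
      (by simp; omega)
    simp [hrq, hr]

theorem moveBoth {l : List Γ'} (hrq : r ≠ q) (hrq' : r ≠ q') (hqq' : q ≠ q') (hr : s r = l)
    (h₁ : s' r = []) (h₂ : s' q = l.reverse ++ s q) (h₂' : s' q' = l.reverse ++ s q')
    (h₃ : ∀ i, i ≠ r → i ≠ q → i ≠ q' → s' i = s i) :
    Runs (Prog.moveBoth r q q') s (14 * l.length + 1) s' := by
  induction l generalizing s with
  | nil =>
    have : s' = s := by
      funext i
      by_cases hi : i = r
      · rw [hi, h₁, hr]
      · by_cases hi' : i = q
        · rw [hi', h₂]; rfl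
        · by_cases hi'' : i = q'
          · rw [hi'', h₂']; rfl
          · exact h₃ i hi hi' hi''
    subst this
    exact loop_false (by simp [hr])
  | cons a l ih =>
    have := ih (s := update (update (update s q (a :: s q)) q' (a :: s q')) r l) (by simp)
      (by simp [hrq.symm, hqq', h₂]) (by simp [hrq'.symm, h₂'])
      (fun i hi hi' hi'' => by simp [hi, hi', hi'', h₃])
    refine (loop_true (by simp [hr]) (seq (copyTop (a := a) (by simp [hr]) rfl)
      (seq (copyTop (a := a) (by simp [hr, hrq]) rfl) (pop ?_))) this).mono
      (by simp; omega)
    simp [hrq, hrq', hr, hqq'.symm]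

theorem clear (hs' : s' = update s r []) : Runs (Prog.clear r) s (2 * (s r).length + 1) s' := by
  subst hs'
  generalize hl : s r = l
  induction l generalizing s with
  | nil =>
    have h : Runs (Prog.clear r) s 1 s := loop_false (by rw [hl]; rfl)
    have e : update s r [] = s := by rw [← hl, update_eq_self]
    rwa [e]
  | cons a l ih =>
    have := ih (s := update s r l) (by simp)
    rw [update_idem] at this
    exact (loop_true (by simp [hl]) (pop (by simp [hl])) this).mono (by simp; omega)

theorem write {l : List Γ'} (hs' : s' = update s r (l ++ s r)) :
    Runs (Prog.write r l) s (l.length + 1) s' := by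
  subst hs'
  induction l with
  | nil =>
    rw [List.nil_append, update_eq_self]
    exact skip
  | cons a l ih => exact seq ih (push (by simp))

end Runs

/-! ### Trees and their strings -/

/-- Binary trees, as universal data. -/
inductive Data
  | nil
  | node (a b : Data)
  deriving DecidableEq

namespace Data

/-- The string of a tree in Polish notation. -/
def str : Data → List Γ'
  | nil => [.bit false]
  | node a b => .bit true :: (a.str ++ b.str)

/-- Polish notation is a prefix code. The arbitrary remainders `l` and `l'` make the induction pass
from the left subtree to the right one. -/
theorem append_str_inj {a b : Data} {l l' : List Γ'} (h : a.str ++ l = b.str ++ l') :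
    a = b ∧ l = l' := by
  induction a generalizing b l l' with
  | nil => cases b <;> simp_all [str]
  | node a₁ a₂ ih₁ ih₂ =>
    cases b with
    | nil => simp [str] at h
    | node b₁ b₂ =>
      simp only [str, List.cons_append, List.cons.injEq, true_and, List.append_assoc] at h
      obtain ⟨rfl, h'⟩ := ih₁ h
      obtain ⟨rfl, h''⟩ := ih₂ h'
      exact ⟨rfl, h''⟩

theorem str_inj {a b : Data} : a.str = b.str ↔ a = b :=
  ⟨fun h => (append_str_inj (l := []) (l' := []) (by rw [h])).1, fun h => h ▸ rfl⟩

theorem length_str_pos (a : Data) : 0 < a.str.length := by cases a <;> simp [str]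

end Data

/-- Test for the first symbol of the string of an inner node. -/
def isNode : Option Γ' → Bool := (· = some (.bit true))

/-- Move the string of a tree from the top of `r` to `q`, reversing it; the register `c` serves as a
counter. -/
def Prog.moveTree (r q c : ℕ) : Prog :=
  .seq (.push c .blank) <| .loop c Option.isSome <|
    .ite r isNode (.seq (.pop r) (.seq (.push q (.bit true)) (.push c .blank)))
      (.seq (.pop r) (.seq (.push q (.bit false)) (.pop c)))

/-- The counter holds one symbol per tree still to be read: a node replaces one pending tree by two,
a leaf settles one. Both subtrees of a node are consumed by the same loop, so the induction is in
continuation form: a run of the loop from the store after the tree `d` is extended to a run from the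
store before it. Each symbol costs five steps. -/
theorem runs_moveTree_aux {r q c : ℕ} (hrq : r ≠ q) (hrc : r ≠ c) (hqc : q ≠ c) (d : Data) :
    ∀ {s s' : Store} {T : ℕ} {l : List Γ'} {x : Γ'} {m : List Γ'}, s r = d.str ++ l → s c = x :: m →
      Runs (.loop c Option.isSome <|
        .ite r isNode (.seq (.pop r) (.seq (.push q (.bit true)) (.push c .blank)))
          (.seq (.pop r) (.seq (.push q (.bit false)) (.pop c))))
        (update (update (update s r l) q (d.str.reverse ++ s q)) c m) T s' →
      Runs (.loop c Option.isSome <|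
        .ite r isNode (.seq (.pop r) (.seq (.push q (.bit true)) (.push c .blank)))
          (.seq (.pop r) (.seq (.push q (.bit false)) (.pop c)))) s (5 * d.str.length + T) s' := by
  induction d with
  | nil =>
    intro s s' T l x m hr hc h
    simp only [Data.str, List.singleton_append] at hr
    refine (Runs.loop_true (by simp [hc]) (Runs.ite_false (by simp [hr, isNode])
      (Runs.seq (Runs.pop rfl) (Runs.seq (Runs.push rfl) (Runs.pop rfl)))) (s' := _) ?_).mono
      (T := 1 + (1 + (1 + (1 + 1))) + T) (by simp [Data.str])
    simpa [hr, hc, hrq.symm, hrc.symm, hqc.symm, Data.str] using h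
  | node a b iha ihb =>
    intro s s' T l x m hr hc h
    simp only [Data.str, List.cons_append, List.append_assoc] at hr
    refine (Runs.loop_true (by simp [hc]) (Runs.ite_true (by simp [hr, isNode])
      (Runs.seq (Runs.pop rfl) (Runs.seq (Runs.push rfl) (Runs.push rfl)))) (s' := _)
      (iha (l := b.str ++ l) (x := .blank) (m := x :: m) ?_ ?_
        (ihb (l := l) (x := x) (m := m) ?_ ?_ (T := T) ?_))).mono
      (by simp [Data.str]; omega)
    · simp [hr, hrq, hrc]
    · simp [hc, hrc.symm, hqc.symm]
    · simp [hrq, hrc]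
    · simp
    · convert h using 1
      funext i
      simp only [update_apply]
      split_ifs <;> simp_all [Data.str]

theorem Runs.moveTree {r q c : ℕ} (hrq : r ≠ q) (hrc : r ≠ c) (hqc : q ≠ c) {d : Data}
    {s s' : Store} {l : List Γ'} (hr : s r = d.str ++ l) (hs' : s' c = s c) (h₁ : s' r = l)
    (h₂ : s' q = d.str.reverse ++ s q) (hc : s c = []) (h₃ : ∀ i, i ≠ r → i ≠ q → s' i = s i) :
    Runs (Prog.moveTree r q c) s (5 * d.str.length + 2) s' := by
  have := runs_moveTree_aux hrq hrc hqc d (s := update s c [.blank]) (l := l) (x := .blank)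
    (m := []) (by simp [hr, hrc]) (by simp) (loop_false (by simp))
  have hp : Runs (Prog.moveTree r q c) s (1 + (5 * d.str.length + 1)) _ :=
    (Runs.push (a := .blank) (by rw [hc])).seq this
  convert hp.mono (T' := 5 * d.str.length + 2) (by omega) using 1
  funext i
  simp only [update_apply]
  split_ifs <;> simp_all

/-! ### Functions computable in polynomial time -/

/-- Types whose elements are represented by trees. -/
class Enc (α : Type) where
  enc : α → Data

open Enc (enc)

/-- The length of the string of the tree of `a`. -/
def size {α : Type} [Enc α] (a : α) : ℕ := (enc a).str.length

instance : Enc Data := ⟨id⟩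

instance {α β : Type} [Enc α] [Enc β] : Enc (α × β) := ⟨fun x => .node (enc x.1) (enc x.2)⟩

/-- The tree of a list. -/
def encList {α : Type} [Enc α] : List α → Data
  | [] => .nil
  | a :: l => .node (enc a) (encList l)

instance {α : Type} [Enc α] : Enc (List α) := ⟨encList⟩

/-- Elements of a subtype keep their trees, so restricting a function to a subtype costs nothing. -/
instance {α : Type} [Enc α] {P : α → Prop} : Enc {a // P a} := ⟨fun a => enc a.1⟩

/-- The first symbol of the string distinguishes the two values, so `isNode` can branch on it. -/
instance : Enc Bool := ⟨fun b => if b then .node .nil .nil else .nil⟩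

section

variable {α β γ δ : Type} [Enc α] [Enc β] [Enc γ] [Enc δ]

theorem size_pos (a : α) : 0 < size a := (enc a).length_str_pos

@[simp] theorem size_pair (a : α) (b : β) : size (a, b) = 1 + size a + size b := by
  simp [size, enc, Data.str]; omega

@[simp] theorem size_nil : size ([] : List α) = 1 := rfl

@[simp] theorem size_cons (a : α) (l : List α) : size (a :: l) = 1 + size a + size l := by
  simp [size, enc, encList, Data.str]; omega

theorem length_le_size (l : List α) : l.length ≤ size l := by
  induction l with
  | nil => simp
  | cons a l ih => simp; omega

/-- The function `f` is computable in polynomial time: some program replaces the string of `a` in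
register `0` by that of `f a`, using finitely many further registers, which have to be empty. -/
def PolyFun (f : α → β) : Prop :=
  ∃ (p : Prog) (n : ℕ) (T : Polynomial ℕ), ∀ (a : α) (s : Store), s 0 = (enc a).str →
    (∀ i, 0 < i → i < n → s i = []) → Runs p s (T.eval (size a)) (update s 0 (enc (f a)).str)

theorem eval_mono (T : Polynomial ℕ) {m n : ℕ} (h : m ≤ n) : T.eval m ≤ T.eval n := by
  induction T using Polynomial.induction_on' with
  | add p q hp hq => simpa using add_le_add hp hq
  | monomial k a => simpa using Nat.mul_le_mul_left a (Nat.pow_le_pow_left h k)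

namespace PolyFun

/-- The output is built in register `0`, which grows by at most one symbol per step. This bound is
what makes running times compose. -/
theorem size_le {f : α → β} (hf : PolyFun f) :
    ∃ Q : Polynomial ℕ, ∀ a, size (f a) ≤ Q.eval (size a) := by
  obtain ⟨p, n, T, h⟩ := hf
  refine ⟨.X + T, fun a => ?_⟩
  obtain ⟨t, ht, hx⟩ := h a (update (fun _ => []) 0 (enc a).str) (by simp)
    (fun i hi _ => by simp [hi.ne'])
  have := hx.length_le 0
  simp only [update_self] at this
  simp only [Polynomial.eval_add, Polynomial.eval_X]
  exact this.trans (Nat.add_le_add_left ht _)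

/-- A function that does not change the tree is computable in polynomial time. -/
theorem of_enc_eq {f : α → β} (h : ∀ a, enc (f a) = enc a) : PolyFun f :=
  ⟨.skip, 0, 1, fun a s hs _ => by
    rw [h, ← hs, update_eq_self]
    exact Runs.skip.mono (by simp)⟩

theorem id : PolyFun (fun a : α => a) := of_enc_eq fun _ => rfl

theorem congr {f g : α → β} (hf : PolyFun f) (h : ∀ a, f a = g a) : PolyFun g :=
  (funext h : f = g) ▸ hf

theorem comp {g : β → γ} {f : α → β} (hg : PolyFun g) (hf : PolyFun f) :
    PolyFun (fun a => g (f a)) := by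
  obtain ⟨Q, hQ⟩ := hf.size_le
  obtain ⟨p, n, T, h⟩ := hf
  obtain ⟨p', n', T', h'⟩ := hg
  refine ⟨.seq p p', max n n', T + T'.comp Q, fun a s hs hi => ?_⟩
  have h1 := h a s hs (fun i h0 h1 => hi i h0 (by omega))
  have h2 := h' (f a) (update s 0 (enc (f a)).str) (by simp)
    (fun i h0 h1 => by simpa [h0.ne'] using hi i h0 (by omega))
  refine (h1.seq (s'' := update s 0 (enc (g (f a))).str) (by simpa using h2)).mono ?_
  simpa using eval_mono T' (hQ a)

theorem const (b : β) : PolyFun (fun _ : α => b) := by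
  refine ⟨.seq (.clear 0) (.write 0 (enc b).str), 0, 2 * .X + .C ((enc b).str.length + 2),
    fun a s hs _ => ?_⟩
  refine ((Runs.clear rfl).seq (Runs.write ?_)).mono ?_
  · simp
  · simp [hs, size]; omega

theorem fst : PolyFun (fun x : α × β => x.1) := by
  refine ⟨.seq (.pop 0) (.seq (.moveTree 0 1 2) (.seq (.clear 0) (.move 1 0))), 3,
    20 * .X + 20, fun x s hs hi => ?_⟩
  obtain ⟨a, b⟩ := x
  have h1 := hi 1 (by omega) (by omega)
  have h2 := hi 2 (by omega) (by omega)
  replace hs : s 0 = .bit true :: ((enc a).str ++ (enc b).str) := hs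
  refine ((Runs.pop rfl).seq <|
    (Runs.moveTree (s' := update (update s 0 (enc b).str) 1 (enc a).str.reverse)
      (d := enc a) (l := (enc b).str) (by simp) (by simp) (by simp) (by simp [hs]) ?_ (by simp)
      (by simp [h1]) (by simp [h2]) ?_).seq <|
    (Runs.clear (s' := update (update s 0 []) 1 (enc a).str.reverse) ?_).seq <|
    Runs.move (l := (enc a).str.reverse) (by simp) (by simp) (by simp [h1]) (by simp) ?_).mono ?_
  · simp
  · intro i h0 h1
    simp [h0, h1]
  · funext i
    simp only [update_apply]
    split_ifs <;> simp_all
  · intro i h0 h1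
    simp [h0, h1]
  · have hab : (enc (a, b)).str.length = 1 + (enc a).str.length + (enc b).str.length :=
      size_pair a b
    simp [size] at *
    omega

theorem snd : PolyFun (fun x : α × β => x.2) := by
  refine ⟨.seq (.pop 0) (.seq (.moveTree 0 1 2) (.clear 1)), 3,
    20 * .X + 20, fun x s hs hi => ?_⟩
  obtain ⟨a, b⟩ := x
  have h1 := hi 1 (by omega) (by omega)
  have h2 := hi 2 (by omega) (by omega)
  replace hs : s 0 = .bit true :: ((enc a).str ++ (enc b).str) := hs
  refine ((Runs.pop rfl).seq <|
    (Runs.moveTree (s' := update (update s 0 (enc b).str) 1 (enc a).str.reverse)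
      (d := enc a) (l := (enc b).str) (by simp) (by simp) (by simp) (by simp [hs]) ?_ (by simp)
      (by simp [h1]) (by simp [h2]) ?_).seq <|
    (Runs.clear ?_)).mono ?_
  · simp
  · intro i h0 h1
    simp [h0, h1]
  · funext i
    simp only [update_apply]
    split_ifs <;> simp_all
  · have hab : (enc (a, b)).str.length = 1 + (enc a).str.length + (enc b).str.length :=
      size_pair a b
    simp [size] at *
    omega

theorem pair {f : α → β} {g : α → γ} (hf : PolyFun f) (hg : PolyFun g) :
    PolyFun (fun a => (f a, g a)) := by
  obtain ⟨Q, hQ⟩ := hf.size_le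
  obtain ⟨p, n, T, h⟩ := hf
  obtain ⟨p', n', T', h'⟩ := hg
  -- Registers from `N` on need not be empty for either program and are unchanged after it. Register
  -- `N` keeps a copy of the input, `N + 1` holds first the reversed input and then the reversed `f
  -- a`, and `N + 2` restores the orientation, since every move reverses.
  obtain ⟨N, hN, hn, hn'⟩ : ∃ N, 0 < N ∧ n ≤ N ∧ n' ≤ N := ⟨n + n' + 1, by omega⟩
  refine ⟨.seq (.move 0 (N + 1)) <| .seq (.moveBoth (N + 1) 0 N) <| .seq p <|
    .seq (.move 0 (N + 1)) <| .seq (.move N (N + 2)) <| .seq (.move (N + 2) 0) <| .seq p' <|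
    .seq (.move (N + 1) 0) (.push 0 (.bit true)), N + 3, 38 * .X + 16 * Q + T + T' + 10,
    fun a s hs hi => ?_⟩
  have e0 := hi N (by omega) (by omega)
  have e1 := hi (N + 1) (by omega) (by omega)
  have e2 := hi (N + 2) (by omega) (by omega)
  have hx := h a (update s N (enc a).str) (by simp [hN.ne, hs])
    (fun i h0 h1 => by simp [show i ≠ N by omega]; exact hi i h0 (by omega))
  have hy := h' a (update (update s N []) (N + 1) (enc (f a)).str.reverse) (by simp [hN.ne, hs])
    (fun i h0 h1 => by
      simp [show i ≠ N by omega, show i ≠ N + 1 by omega]; exact hi i h0 (by omega))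
  refine ((Runs.move (s' := update (update s 0 []) (N + 1) (enc a).str.reverse)
      (l := (enc a).str) (by simp) hs (by simp) (by simp [e1]) ?_).seq <|
    (Runs.moveBoth (s' := update s N (enc a).str) (l := (enc a).str.reverse)
      (by simp) (by simp) (by omega) (by simp) (by simp [e1]) (by simp [hN.ne, hs])
      (by simp [hN.ne', e0]) ?_).seq <|
    hx.seq <|
    (Runs.move (s' := update (update (update s N (enc a).str) 0 []) (N + 1)
      (enc (f a)).str.reverse)
      (l := (enc (f a)).str) (by simp) (by simp) (by simp) (by simp [e1]) ?_).seq <|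
    (Runs.move (s' := update (update (update (update s N []) 0 []) (N + 1)
      (enc (f a)).str.reverse) (N + 2) (enc a).str.reverse)
      (l := (enc a).str) (by simp) (by simp [hN.ne']) (by simp [hN.ne']) (by simp [e2]) ?_).seq <|
    (Runs.move (s' := update (update s N []) (N + 1) (enc (f a)).str.reverse)
      (l := (enc a).str.reverse) (by simp) (by simp) (by simp [e2]) (by simp [hN.ne, hs])
      ?_).seq <|
    hy.seq <|
    (Runs.move (s' := update s 0 ((enc (f a)).str ++ (enc (g a)).str))
      (l := (enc (f a)).str.reverse) (by simp) (by simp) (by simp [e1]) (by simp)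
      ?_).seq <|
    Runs.push ?_).mono ?_
  · intro i h0 h1
    simp [h0, h1]
  · intro i h0 h1 h2
    simp [h0, h1, h2]
  · intro i h0 h1
    simp [h0, h1]
  · intro i h0 h1
    simp only [update_apply]
    split_ifs <;> simp_all
  · intro i h0 h1
    simp only [update_apply]
    split_ifs <;> simp_all
  · intro i h0 h1
    simp only [update_apply]
    split_ifs <;> simp_all
  · simp [enc, Data.str]
  · have := hQ a
    simp only [size] at *
    simp
    omega

/-- Programs only see trees, so a value may be reinterpreted in another type in which it has the
same tree. -/
theorem congr_enc {f : α → β} {g : α → γ} (hf : PolyFun f) (h : ∀ a, enc (g a) = enc (f a)) :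
    PolyFun g := by
  obtain ⟨p, n, T, hp⟩ := hf
  exact ⟨p, n, T, fun a s hs hi => h a ▸ hp a s hs hi⟩

/-- Each branch has to be computable only on the inputs that reach it, which allows it to use the
condition. -/
theorem dite {P : α → Prop} [DecidablePred P] {f : {a // P a} → β} {g : {a // ¬P a} → β}
    (hP : PolyFun fun a => decide (P a)) (hf : PolyFun f) (hg : PolyFun g) :
    PolyFun (fun a => if h : P a then f ⟨a, h⟩ else g ⟨a, h⟩) := by
  obtain ⟨p₀, n₀, T₀, h₀⟩ := hP.pair id
  obtain ⟨p, n, T, h⟩ := hf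
  obtain ⟨p', n', T', h'⟩ := hg
  -- After the node symbol of the pair has been removed, three pops delete the string of `true`, and
  -- one pop deletes that of `false`; the input is left.
  refine ⟨.seq p₀ <| .seq (.pop 0) <| .ite 0 isNode
      (.seq (.pop 0) <| .seq (.pop 0) <| .seq (.pop 0) p) (.seq (.pop 0) p'), max n₀ (max n n'),
      T₀ + T + T' + 5, fun a s hs hi => ?_⟩
  have hx := h₀ a s hs (fun i h0 h1 => hi i h0 (by omega))
  have hu (l : List Γ') : ∀ i, 0 < i → i < max n₀ (max n n') → update s 0 l i = [] :=
    fun i h0 h1 => by simpa [h0.ne'] using hi i h0 h1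
  refine (hx.seq (T' := T.eval (size a) + T'.eval (size a) + 5) ?_).mono
    (by simp; omega)
  by_cases ha : P a
  · have hy := h ⟨a, ha⟩ (update s 0 (enc a).str) (by simp; rfl)
      (fun i h0 h1 => hu _ i h0 (by omega))
    rw [update_idem] at hy
    simp only [dif_pos ha]
    refine Runs.mono ((Runs.pop rfl).seq (Runs.ite_true (by simp [enc, ha, Data.str, isNode])
        ((Runs.pop rfl).seq <| (Runs.pop rfl).seq <| (Runs.pop ?_).seq hy))) ?_
    · simp [enc, ha, Data.str]
    · change 1 + (1 + (1 + (1 + (1 + T.eval (size a))))) ≤ _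
      omega
  · have hy := h' ⟨a, ha⟩ (update s 0 (enc a).str) (by simp; rfl)
      (fun i h0 h1 => hu _ i h0 (by omega))
    rw [update_idem] at hy
    simp only [dif_neg ha]
    refine Runs.mono ((Runs.pop rfl).seq (Runs.ite_false (by simp [enc, ha, Data.str, isNode])
        ((Runs.pop ?_).seq hy))) ?_
    · simp [enc, ha, Data.str]
    · change 1 + (1 + (1 + T'.eval (size a))) ≤ _
      omega

theorem val {P : α → Prop} : PolyFun (fun a : {a // P a} => a.1) := of_enc_eq fun _ => rfl

theorem ite {P : α → Prop} [DecidablePred P] {f g : α → β} (hP : PolyFun fun a => decide (P a))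
    (hf : PolyFun f) (hg : PolyFun g) : PolyFun (fun a => if P a then f a else g a) :=
  (hP.dite (hf.comp val) (hg.comp val)).congr fun a => by simp

end PolyFun

end

/-! ### Iteration along a list -/

section

variable {α β γ δ : Type} [Enc α] [Enc β] [Enc γ] [Enc δ]

theorem size_le_of_mem {l : List α} {a : α} (h : a ∈ l) : size a ≤ size l := by
  induction l with
  | nil => simp at h
  | cons b l ih =>
    simp only [size_cons]
    rcases List.mem_cons.1 h with rfl | h
    · omega
    · have := ih h; omega

/-- The body of the loop that computes a fold: `n` holds the remaining list. -/
def Prog.foldlBody (p : Prog) (n : ℕ) : Prog :=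
  .seq (.pop n) <| .seq (.moveTree n (n + 1) (n + 2)) <| .seq (.move 0 (n + 3)) <|
    .seq (.move (n + 1) 0) <| .seq (.move (n + 3) 0) <| .seq (.push 0 (.bit true)) p

theorem runs_foldlBody {step : β × α → β} {p : Prog} {n : ℕ} {T : Polynomial ℕ} (hn : 0 < n)
    (h : ∀ (a : β × α) (s : Store), s 0 = (enc a).str →
      (∀ i, 0 < i → i < n → s i = []) → Runs p s (T.eval (size a)) (update s 0 (enc (step a)).str))
    {s : Store} {b : β} {a : α} {l : List α} (h₀ : s 0 = (enc b).str)
    (h₁ : s n = (enc (a :: l)).str) (h₂ : ∀ i, 0 < i → i < n + 4 → i ≠ n → s i = []) :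
    Runs (.foldlBody p n) s (13 * size a + 16 * size b + 7 + T.eval (1 + size b + size a))
      (update (update s n (enc l).str) 0 (enc (step (b, a))).str) := by
  have e1 := h₂ (n + 1) (by omega) (by omega) (by omega)
  have e2 := h₂ (n + 2) (by omega) (by omega) (by omega)
  have e3 := h₂ (n + 3) (by omega) (by omega) (by omega)
  have hs := h (b, a) (update (update s n (enc l).str) 0 (enc (b, a)).str) (by simp)
    (fun i hi hi' => by
      simp [hi.ne', hi'.ne]
      exact h₂ i hi (by omega) hi'.ne)
  rw [update_idem, size_pair] at hs
  replace h₁ : s n = .bit true :: ((enc a).str ++ (enc l).str) := h₁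
  -- The string of the pair is built from its end: the item, on top of it the accumulator, then the
  -- node symbol.
  refine ((Runs.pop rfl).seq <|
    (Runs.moveTree (s' := update (update s n (enc l).str) (n + 1) (enc a).str.reverse)
      (d := enc a) (l := (enc l).str) (by simp) (by simp) (by simp) (by simp [h₁]) (by simp)
      (by simp) (by simp [e1]) (by simp [e2]) ?_).seq <|
    (Runs.move (s' := update (update (update (update s n (enc l).str) (n + 1)
        (enc a).str.reverse) (n + 3) (enc b).str.reverse) 0 [])
      (l := (enc b).str) (by simp) (by simp [h₀, hn.ne]) (by simp) (by simp [e3]) ?_).seq <|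
    (Runs.move (s' := update (update (update s n (enc l).str) (n + 3) (enc b).str.reverse) 0
        (enc a).str)
      (l := (enc a).str.reverse) (by simp) (by simp) (by simp [e1]) (by simp) ?_).seq <|
    (Runs.move (s' := update (update s n (enc l).str) 0 ((enc b).str ++ (enc a).str))
      (l := (enc b).str.reverse) (by simp) (by simp) (by simp [e3]) (by simp) ?_).seq <|
    (Runs.push ?_).seq hs).mono ?_
  · intro i hi hi'
    simp [hi, hi']
  · intro i hi hi'
    simp [hi, hi']
  · intro i hi hi'
    simp only [update_apply]
    split_ifs <;> simp_all
  · intro i hi hi'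
    simp only [update_apply]
    split_ifs <;> simp_all
  · simp [enc, Data.str]
  · simp [size]
    omega

/-- Iterating a polynomial-time step can make the accumulator grow exponentially, so `B` has to
bound every intermediate accumulator, that is, the fold over every prefix. The remaining list is
nonempty exactly if its string begins with a node symbol, which is the loop test. -/
theorem runs_foldl_loop {step : β × α → β} {p : Prog} {n : ℕ} {T : Polynomial ℕ} (hn : 0 < n)
    (h : ∀ (a : β × α) (s : Store), s 0 = (enc a).str →
      (∀ i, 0 < i → i < n → s i = []) → Runs p s (T.eval (size a)) (update s 0 (enc (step a)).str))
    (B : ℕ) (l : List α) : ∀ (b : β) (s : Store), s 0 = (enc b).str → s n = (enc l).str →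
      (∀ i, 0 < i → i < n + 4 → i ≠ n → s i = []) → (∀ a ∈ l, size a ≤ B) →
      (∀ l', l' <+: l → size (l'.foldl (fun b a => step (b, a)) b) ≤ B) →
      Runs (.loop n isNode (.foldlBody p n)) s
        (l.length * (29 * B + 8 + T.eval (1 + B + B)) + 1)
        (update (update s n [.bit false]) 0
          (enc (l.foldl (fun b a => step (b, a)) b)).str) := by
  induction l with
  | nil =>
    intro b s h₀ h₁ _ _ _
    replace h₁ : s n = [.bit false] := h₁
    have e : update (update s n [.bit false]) 0 (enc b).str = s := by
      rw [← h₁, update_eq_self, ← h₀, update_eq_self]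
    simp only [List.foldl_nil, e]
    exact (Runs.loop_false (by simp [h₁, isNode])).mono (by omega)
  | cons a l ih =>
    intro b s h₀ h₁ h₂ h₃ h₄
    have hb := h₄ [] (List.nil_prefix)
    have ha := h₃ a (by simp)
    have h5 := ih (step (b, a)) (update (update s n (enc l).str) 0 (enc (step (b, a))).str)
      (by simp) (by simp [hn.ne']) (fun i hi hi' hi'' => by simp [hi.ne', hi'', h₂ i hi hi' hi''])
      (fun a ha => h₃ a (by simp [ha]))
      (fun l' hl' => h₄ (a :: l') (by simpa using hl'))
    have e : update (update (update (update s n (enc l).str) 0 (enc (step (b, a))).str) n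
        [.bit false]) 0 (enc (l.foldl (fun b a => step (b, a)) (step (b, a)))).str =
        update (update s n [.bit false]) 0
          (enc (l.foldl (fun b a => step (b, a)) (step (b, a)))).str := by
      funext i
      simp only [update_apply]
      split_ifs <;> simp_all
    rw [e] at h5
    refine (Runs.loop_true (by rw [h₁]; simp [enc, encList, Data.str, isNode])
      (runs_foldlBody hn h h₀ h₁ h₂) h5).mono ?_
    simp only [List.foldl_nil] at hb
    have := eval_mono T (show 1 + size b + size a ≤ 1 + B + B by omega)
    simp only [List.length_cons, Nat.add_mul]
    omega

/-- The type `ι`, whose elements `x` are represented by `b x` and `l x`. -/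
def FoldInput {ι : Type} (_b : ι → β) (_l : ι → List α) : Type := ι

instance {ι : Type} (b : ι → β) (l : ι → List α) : Enc (FoldInput b l) :=
  ⟨fun x : ι => enc (b x, l x)⟩

/-- The size bound `hQ` is available only for pairs of the form `(b x, l x)`, not for all starting
values and lists. This is why the domain is `FoldInput b l` instead of the full product. -/
theorem PolyFun.foldlInput {ι : Type} {b : ι → β} {l : ι → List α} {step : β × α → β}
    (hstep : PolyFun step) (Q : Polynomial ℕ)
    (hQ : ∀ (x : ι) (l' : List α), l' <+: l x →
      size (l'.foldl (fun b a => step (b, a)) (b x)) ≤ Q.eval (size (b x, l x))) :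
    PolyFun (α := FoldInput b l) (fun x => (l x).foldl (fun b a => step (b, a)) (b x)) := by
  obtain ⟨p, n, T, h⟩ := hstep
  -- Registers `1`, `2`, `3` serve to unpack the input, so the list is kept beyond them and beyond
  -- the registers of the step.
  obtain ⟨N, hN, hn⟩ : ∃ N, 3 < N ∧ n ≤ N := ⟨n + 4, by omega⟩
  replace h : ∀ (a : β × α) (s : Store), s 0 = (enc a).str → (∀ i, 0 < i → i < N → s i = []) →
      Runs p s (T.eval (size a)) (update s 0 (enc (step a)).str) :=
    fun a s hs hi => h a s hs fun i h0 h1 => hi i h0 (lt_of_lt_of_le h1 hn)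
  refine ⟨.seq (.pop 0) <| .seq (.moveTree 0 1 2) <| .seq (.move 0 3) <| .seq (.move 3 N) <|
    .seq (.move 1 0) <| .seq (.loop N isNode (.foldlBody p N)) (.pop N), N + 4,
    .X * (29 * (Q + .X) + 8 + T.comp (1 + (Q + .X) + (Q + .X))) + 29 * .X + 16,
    fun x s hs hi => ?_⟩
  replace hs : s 0 = .bit true :: ((enc (b x)).str ++ (enc (l x)).str) := hs
  replace hQ := hQ x
  change Runs _ _ (Polynomial.eval (size (b x, l x)) _)
    (update s 0 (enc ((l x).foldl (fun b a => step (b, a)) (b x))).str)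
  generalize b x = b at *
  generalize l x = l at *
  have e1 := hi 1 (by omega) (by omega)
  have e2 := hi 2 (by omega) (by omega)
  have e3 := hi 3 (by omega) (by omega)
  have eN := hi N (by omega) (by omega)
  have h1N : 1 ≠ N := by omega
  have h0N : 0 ≠ N := by omega
  have h3N : 3 ≠ N := by omega
  -- The summand `.X` makes `B` bound the items of the list as well as the accumulators.
  set B := (Q + .X).eval (size (b, l)) with hB
  have hBQ : B = Q.eval (size (b, l)) + (1 + size b + size l) := by simp [hB]
  have h5 := runs_foldl_loop (s := update (update s N (enc l).str) 0 (enc b).str)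
    (by omega) h B l b (by simp) (by simp [h0N.symm])
    (fun i h0 h1 h2 => by simp [h0.ne', h2, hi i h0 h1])
    (fun a ha => by have := size_le_of_mem ha; omega)
    (fun l' hl' => by have := hQ l' hl'; omega)
  have e5 : update (update (update (update s N (enc l).str) 0 (enc b).str) N [.bit false]) 0
      (enc (l.foldl (fun b a => step (b, a)) b)).str = update (update s N [.bit false]) 0
      (enc (l.foldl (fun b a => step (b, a)) b)).str := by
    funext i
    simp only [update_apply]
    split_ifs <;> simp_all
  rw [e5] at h5
  refine ((Runs.pop rfl).seq <|
    (Runs.moveTree (s' := update (update s 0 (enc l).str) 1 (enc b).str.reverse)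
      (d := enc b) (l := (enc l).str) (by simp) (by simp) (by simp) (by simp [hs]) (by simp)
      (by simp) (by simp [e1]) (by simp [e2]) ?_).seq <|
    (Runs.move (s' := update (update (update s 0 []) 1 (enc b).str.reverse) 3
      (enc l).str.reverse)
      (l := (enc l).str) (by simp) (by simp) (by simp) (by simp [e3]) ?_).seq <|
    (Runs.move (s' := update (update (update s 0 []) 1 (enc b).str.reverse) N (enc l).str)
      (l := (enc l).str.reverse) h3N (by simp) (by simp [e3, h3N]) (by simp [eN, h1N.symm, h0N.symm, h3N.symm])
      ?_).seq <|
    (Runs.move (s' := update (update s N (enc l).str) 0 (enc b).str)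
      (l := (enc b).str.reverse) (by simp) (by simp [h1N]) (by simp [e1, h1N]) (by simp [h0N])
      ?_).seq <|
    h5.seq (Runs.pop ?_)).mono ?_
  · intro i h0 h1
    simp [h0, h1]
  · intro i h0 h1
    simp only [update_apply, h0, h1, if_false]
  · intro i h0 h1
    simp only [update_apply, h0, h1, if_false]
  · intro i h0 h1
    simp only [update_apply, h0, h1, if_false]
  · funext i
    rcases eq_or_ne i 0 with rfl | h0
    · simp [h0N]
    · rcases eq_or_ne i N with rfl | h1
      · simp [h0, eN]
      · simp [h0, h1]
  · have h6 := length_le_size l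
    have h7 : Polynomial.eval (size (b, l)) ((.X : Polynomial ℕ) * (29 * (Q + .X) + 8 +
        T.comp (1 + (Q + .X) + (Q + .X))) + 29 * .X + 16) =
        size (b, l) * (29 * B + 8 + T.eval (1 + B + B)) + 29 * size (b, l) + 16 := by
      simp only [Polynomial.eval_add, Polynomial.eval_mul, Polynomial.eval_comp, Polynomial.eval_X,
        Polynomial.eval_ofNat, Polynomial.eval_one, hB]
    rw [h7]
    have h8 := Nat.mul_le_mul_right (29 * B + 8 + T.eval (1 + B + B))
      (show l.length ≤ size (b, l) by simp; omega)
    have h9 := size_pair b l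
    simp only [List.length_reverse]
    change _ + (5 * size b + 2 + (8 * size l + 1 + (8 * size l + 1 + (8 * size b + 1 + _)))) ≤ _
    omega

end

/-! ### Equality test for trees -/

theorem Data.eq_bit_of_mem_str {d : Data} {x : Γ'} (h : x ∈ d.str) : ∃ b, x = .bit b := by
  induction d with
  | nil => exact ⟨_, List.mem_singleton.1 h⟩
  | node a b iha ihb =>
    rcases List.mem_cons.1 h with h | h
    · exact ⟨_, h⟩
    · exact (List.mem_append.1 h).elim iha ihb

/-- Compare the contents of two registers: afterwards `r` is empty, and `q` is empty if and only if
the contents were equal. -/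
def Prog.compare (r q : ℕ) : Prog :=
  .loop r Option.isSome <| .seq
    (.ite r isNode (.ite q isNode (.pop q) (.push q .blank))
      (.ite q (· = some (.bit false)) (.pop q) (.push q .blank)))
    (.pop r)

/-- At the first mismatch a blank is put on `q`. The rest of `r` consists of bits, none of which
matches a blank, so blanks only accumulate and `q` ends nonempty. The bound on `m` is needed for the
cost of clearing `q`. -/
theorem Runs.compare {r q : ℕ} (hrq : r ≠ q) {l : List Γ'} (hl : ∀ x ∈ l, ∃ b, x = .bit b) :
    ∀ {s : Store}, s r = l → ∃ m : List Γ', m.length ≤ (s q).length + l.length ∧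
      (m = [] ↔ l = s q) ∧
      Runs (.compare r q) s (5 * l.length + 1) (update (update s r []) q m) := by
  induction l with
  | nil =>
    intro s hr
    refine ⟨s q, by simp, by rw [eq_comm], ?_⟩
    rw [← hr, update_eq_self, update_eq_self]
    exact Runs.mono (Runs.loop_false (by simp [hr])) (by omega)
  | cons x l ih =>
    intro s hr
    have hl' : ∀ x ∈ l, ∃ b, x = .bit b := fun x hx => hl x (by simp [hx])
    have hbl (l' : List Γ') : l ≠ .blank :: l' := by
      rintro rfl
      obtain ⟨b, hb⟩ := hl' _ (List.mem_cons_self ..)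
      cases hb
    obtain ⟨b, rfl⟩ := hl x (by simp)
    have pops (h : (s q).head? = some (.bit b)) : ∃ m : List Γ',
        m.length ≤ (s q).length + (l.length + 1) ∧ (m = [] ↔ .bit b :: l = s q) ∧
        Runs (.compare r q) (update (update s q (s q).tail) r l) (5 * l.length + 1)
          (update (update s r []) q m) := by
      obtain ⟨m, h1, h2, h3⟩ := ih hl' (s := update (update s q (s q).tail) r l) (by simp)
      obtain ⟨l', hl'⟩ := List.head?_eq_some_iff.1 h
      refine ⟨m, ?_, ?_, ?_⟩
      · simp [hrq.symm] at h1; omega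
      · simp [h2, hrq.symm, hl']
      · convert h3 using 1
        funext i
        simp only [update_apply]
        split_ifs <;> rfl
    have pushes (h : (s q).head? ≠ some (.bit b)) : ∃ m : List Γ',
        m.length ≤ (s q).length + (l.length + 1) ∧ (m = [] ↔ .bit b :: l = s q) ∧
        Runs (.compare r q) (update (update s q (.blank :: s q)) r l) (5 * l.length + 1)
          (update (update s r []) q m) := by
      obtain ⟨m, h1, h2, h3⟩ := ih hl' (s := update (update s q (.blank :: s q)) r l) (by simp)
      refine ⟨m, ?_, ?_, ?_⟩
      · simp [hrq.symm] at h1; omega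
      · simp only [h2, update_of_ne hrq.symm, update_self]
        refine iff_of_false (hbl _) fun h' => h (by simp [← h'])
      · convert h3 using 1
        funext i
        simp only [update_apply]
        split_ifs <;> rfl
    have e (l' : List Γ') : update (update s q l') r l =
        update (update s q l') r (update s q l' r).tail := by
      simp [hrq, hr]
    by_cases h : (s q).head? = some (.bit b)
    · obtain ⟨m, h1, h2, h3⟩ := pops h
      refine ⟨m, h1, h2, Runs.mono (Runs.loop_true (by simp [hr])
        (Runs.seq (T := 3) (T' := 1) ?_ (Runs.pop (e _))) h3)
        (by simp only [List.length_cons]; omega)⟩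
      cases b
      · exact Runs.ite_false (by simp [hr, isNode]) (Runs.ite_true (by simp [h]) (Runs.pop rfl))
      · exact Runs.ite_true (by simp [hr, isNode]) (Runs.ite_true (by simp [h, isNode])
          (Runs.pop rfl))
    · obtain ⟨m, h1, h2, h3⟩ := pushes h
      refine ⟨m, h1, h2, Runs.mono (Runs.loop_true (by simp [hr])
        (Runs.seq (T := 3) (T' := 1) ?_ (Runs.pop (e _))) h3)
        (by simp only [List.length_cons]; omega)⟩
      cases b
      · exact Runs.ite_false (by simp [hr, isNode]) (Runs.ite_false (by simp [h]) (Runs.push rfl))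
      · exact Runs.ite_true (by simp [hr, isNode]) (Runs.ite_false (by simp [h, isNode])
          (Runs.push rfl))

theorem PolyFun.eq_data : PolyFun (fun x : Data × Data => decide (x.1 = x.2)) := by
  refine ⟨.seq (.pop 0) <| .seq (.moveTree 0 1 2) <| .seq (.move 0 2) <| .seq (.compare 1 2) <|
    .seq (.ite 2 Option.isSome (.write 0 (enc false).str) (.write 0 (enc true).str)) (.clear 2),
    3, 20 * .X + 20, fun x s hs hi => ?_⟩
  obtain ⟨a, b⟩ := x
  have e1 := hi 1 (by omega) (by omega)
  have e2 := hi 2 (by omega) (by omega)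
  replace hs : s 0 = .bit true :: (a.str ++ b.str) := hs
  obtain ⟨m, h1, h2, h3⟩ := Runs.compare (r := 1) (q := 2) (by simp) (l := a.str.reverse)
    (fun x hx => Data.eq_bit_of_mem_str (List.mem_reverse.1 hx))
    (s := update (update (update s 0 []) 1 a.str.reverse) 2 b.str.reverse) (by simp)
  refine ((Runs.pop rfl).seq <|
    (Runs.moveTree (s' := update (update s 0 b.str) 1 a.str.reverse)
      (d := a) (l := b.str) (by simp) (by simp) (by simp) (by simp [hs]) (by simp)
      (by simp) (by simp [e1]) (by simp [e2]) ?_).seq <|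
    (Runs.move (s' := update (update (update s 0 []) 1 a.str.reverse) 2 b.str.reverse)
      (l := b.str) (by simp) (by simp) (by simp) (by simp [e2]) ?_).seq <|
    h3.seq <| Runs.seq (T := 5) (s' := update (update s 2 m) 0 (enc (decide (a = b))).str) ?_ <|
    (Runs.clear ?_)).mono ?_
  · intro i h0 h1
    simp [h0, h1]
  · intro i h0 h1
    simp only [update_apply, h0, h1, if_false]
  · simp [Data.str_inj] at h2
    by_cases hab : a = b
    · refine (Runs.ite_false (by simp [h2, hab]) (Runs.write ?_)).mono (T := 1 + 4) le_rfl
      funext i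
      simp only [update_apply]
      split_ifs <;> simp_all
    · refine (Runs.ite_true ?_ (Runs.write ?_)).mono (T := 1 + 2) (by omega)
      · rw [← h2] at hab
        simpa [Option.isSome_iff_ne_none] using hab
      · funext i
        simp only [update_apply]
        split_ifs <;> simp_all
  · funext i
    simp only [update_apply]
    split_ifs <;> simp_all
  · have h4 : size (a, b) = 1 + a.str.length + b.str.length := size_pair a b
    simp at h1
    simp [-size_pair, h4]
    omega

/-! ### Input and output -/

instance : Enc Γ' := ⟨fun
  | .blank => .nil
  | .bit b => .node .nil (enc b)
  | .bra => .node (.node .nil .nil) .nil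
  | .ket => .node (.node .nil .nil) (.node .nil .nil)
  | .comma => .node (.node .nil (.node .nil .nil)) .nil⟩

/-- Push the string of the tree of the symbol on top of `r` to `q`. -/
def Prog.writeTop (r q : ℕ) : Prog :=
  .ite r (· = some (.bit true)) (.write q (enc (Γ'.bit true)).str) <|
  .ite r (· = some (.bit false)) (.write q (enc (Γ'.bit false)).str) <|
  .ite r (· = some .blank) (.write q (enc Γ'.blank).str) <|
  .ite r (· = some .comma) (.write q (enc Γ'.comma).str) <|
  .ite r (· = some .bra) (.write q (enc Γ'.bra).str) <|
  .write q (enc Γ'.ket).str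

theorem Runs.writeTop {s s' : Store} {r q : ℕ} {a : Γ'} (h : (s r).head? = some a)
    (hs' : s' = update s q ((enc a).str ++ s q)) : Runs (.writeTop r q) s 13 s' := by
  subst hs'
  unfold Prog.writeTop
  have hw (a : Γ') : Runs (.write q (enc a).str) s 8 (update s q ((enc a).str ++ s q)) :=
    (write rfl).mono (by rcases a with _ | (_ | _) | _ | _ | _ <;> simp [enc, Data.str])
  rcases a with _ | (_ | _) | _ | _ | _
  · exact (ite_false (by simp [h]) <| ite_false (by simp [h]) <| ite_true (by simp [h]) <|
      hw _).mono (by norm_num)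
  · exact (ite_false (by simp [h]) <| ite_true (by simp [h]) <| hw _).mono (by norm_num)
  · exact (ite_true (by simp [h]) <| hw _).mono (by norm_num)
  · exact (ite_false (by simp [h]) <| ite_false (by simp [h]) <| ite_false (by simp [h]) <|
      ite_false (by simp [h]) <| ite_true (by simp [h]) <| hw _).mono (by norm_num)
  · exact (ite_false (by simp [h]) <| ite_false (by simp [h]) <| ite_false (by simp [h]) <|
      ite_false (by simp [h]) <| ite_false (by simp [h]) <| hw _).mono (by norm_num)
  · exact (ite_false (by simp [h]) <| ite_false (by simp [h]) <| ite_false (by simp [h]) <|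
      ite_true (by simp [h]) <| hw _).mono (by norm_num)

/-- Replace a string in register `0` by the string of its tree. -/
def Prog.readInput : Prog :=
  .seq (.move 0 1) <| .seq (.push 0 (.bit false)) <|
    .loop 1 Option.isSome (.seq (.writeTop 1 0) (.seq (.push 0 (.bit true)) (.pop 1)))

/-- The string of a list grows at its front, so the input is reversed beforehand and its last symbol
is processed first. -/
theorem runs_readInput_loop (l : List Γ') : ∀ (l' : List Γ') (s : Store), s 1 = l →
    s 0 = (enc l').str →
    Runs (.loop 1 Option.isSome (.seq (.writeTop 1 0) (.seq (.push 0 (.bit true)) (.pop 1)))) s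
      (16 * l.length + 1) (update (update s 1 []) 0 (enc (l.reverse ++ l')).str) := by
  induction l with
  | nil =>
    intro l' s h1 h0
    have e : update (update s 1 []) 0 (enc l').str = s := by
      rw [← h1, update_eq_self, ← h0, update_eq_self]
    simpa [e] using Runs.loop_false (by simp [h1])
  | cons a l ih =>
    intro l' s h1 h0
    have h := ih (a :: l') (update (update s 1 l) 0 (enc (a :: l')).str) (by simp) (by simp)
    have e : update (update (update (update s 1 l) 0 (enc (a :: l')).str) 1 []) 0
        (enc (l.reverse ++ a :: l')).str =
        update (update s 1 []) 0 (enc ((a :: l).reverse ++ l')).str := by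
      funext i
      simp only [update_apply]
      split_ifs <;> simp
    rw [e] at h
    refine (Runs.loop_true (by simp [h1]) (Runs.seq (Runs.writeTop (a := a) (by simp [h1]) rfl)
      (Runs.seq (Runs.push rfl) (Runs.pop ?_))) h).mono (by simp only [List.length_cons]; omega)
    funext i
    simp only [update_apply]
    split_ifs <;> simp_all [enc, encList, Data.str]

theorem size_list_symbols_le (l : List Γ') : size l ≤ 8 * l.length + 1 := by
  induction l with
  | nil => simp
  | cons a l ih =>
    have : size a ≤ 7 := by rcases a with _ | (_ | _) | _ | _ | _ <;> simp [size, enc, Data.str]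
    simp only [size_cons, List.length_cons]
    omega

theorem runs_readInput (l : List Γ') :
    Runs .readInput (update (fun _ => []) 0 l) (24 * l.length + 3)
      (update (fun _ => []) 0 (enc l).str) := by
  have h := runs_readInput_loop l.reverse []
    (update (update (fun _ => []) 0 [.bit false]) 1 l.reverse) (by simp) rfl
  have e : update (update (update (update (fun _ => []) 0 [.bit false]) 1 l.reverse) 1 []) 0
      (enc (l.reverse.reverse ++ [])).str = update (fun _ => []) 0 (enc l).str := by
    funext i
    simp only [update_apply]
    split_ifs <;> simp
  rw [e] at h
  refine ((Runs.move (s' := update (fun _ => []) 1 l.reverse) (l := l) (by simp) (by simp) (by simp)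
    (by simp) ?_).seq <| (Runs.push ?_).seq h).mono ?_
  · intro i h0 h1
    simp [h0, h1]
  · funext i
    simp only [update_apply]
    split_ifs <;> simp_all
  · simp only [List.length_reverse]
    omega

/-- A decision problem is in polynomial time if it is decided by a function on strings that is
computable in polynomial time. -/
theorem PolyFun.inPolyTime {F : List Γ' → Bool} (hF : PolyFun F) {α : Type} {e : α → List Γ'}
    {P : α → Prop} (h : ∀ a, F (e a) = true ↔ P a) : InPolyTime e P := by
  obtain ⟨p, n, T, hp⟩ := hF
  refine inPolyTime_of_exec (.seq .readInput <| .seq p <|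
    .ite 0 isNode (.seq (.clear 0) (.push 0 (.bit true))) .skip)
    (24 * .X + T.comp (8 * .X + 1) + 20) fun a b hb => ?_
  have e1 : F (e a) = b := by
    rw [Bool.eq_iff_iff, h, hb]
  have h1 := hp (e a) (update (fun _ => []) 0 (enc (e a)).str) (by simp)
    (fun i hi _ => by simp [hi.ne'])
  rw [update_idem, e1] at h1
  have hT := eval_mono T (size_list_symbols_le (e a))
  suffices h2 : Runs (.ite 0 isNode (.seq (.clear 0) (.push 0 (.bit true))) .skip)
      (update (fun _ => []) 0 (enc b).str) 9 (update (fun _ => []) 0 [.bit b]) by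
    refine ((runs_readInput (e a)).seq (h1.seq h2)).mono ?_
    simp
    omega
  cases b
  · exact (Runs.ite_false (by simp [enc, isNode, Data.str]) Runs.skip).mono (by omega)
  · refine (Runs.ite_true (by simp [enc, isNode, Data.str])
      ((Runs.clear rfl).seq (Runs.push ?_))).mono ?_
    · simp
    · simp [enc, Data.str]

section

variable {α β γ δ : Type} [Enc α] [Enc β] [Enc γ] [Enc δ]

/-! ### Folds in a context -/

namespace PolyFun

/-- `foldlInput` takes a step without parameters, so the context `c` is carried along inside the
accumulator. -/
theorem foldl {init : γ → β} {l : γ → List α} {step : γ → β → α → β} (hi : PolyFun init)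
    (hl : PolyFun l) (hs : PolyFun fun x : γ × β × α => step x.1 x.2.1 x.2.2) (Q : Polynomial ℕ)
    (hQ : ∀ c l', l' <+: l c → size (l'.foldl (step c) (init c)) ≤ Q.eval (size c)) :
    PolyFun fun c => (l c).foldl (step c) (init c) := by
  have e (c : γ) (l' : List α) (b : β) :
      l'.foldl (fun (y : γ × β) a => (y.1, step y.1 y.2 a)) (c, b) = (c, l'.foldl (step c) b) := by
    induction l' generalizing b with
    | nil => rfl
    | cons a l' ih => exact ih _
  have hstep : PolyFun fun x : (γ × β) × α => (x.1.1, step x.1.1 x.1.2 x.2) :=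
    (fst.comp fst).pair (hs.comp ((fst.comp fst).pair ((snd.comp fst).pair snd)))
  have key := foldlInput (b := fun c : γ => (c, init c)) (l := l) hstep (1 + .X + Q)
    fun c l' hl' => by
      simp only [e]
      have h1 := hQ c l' hl'
      have h2 := eval_mono Q (show size c ≤ size ((c, init c), l c) by simp; omega)
      simp at h2 ⊢
      omega
  have h1 : PolyFun (β := FoldInput (fun c : γ => (c, init c)) l) (fun c : γ => c) :=
    ((id.pair hi).pair hl).congr_enc fun _ => rfl
  exact (snd.comp (key.comp h1)).congr fun c => by simp only [e]

/-- If a step adds an amount bounded in terms of the context and the item only, the growth over the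
whole list is at most its length times this amount. Most folds below are of this kind. -/
theorem foldl_of_le {init : γ → β} {l : γ → List α} {step : γ → β → α → β} (hi : PolyFun init)
    (hl : PolyFun l) (hs : PolyFun fun x : γ × β × α => step x.1 x.2.1 x.2.2) (K : Polynomial ℕ)
    (hK : ∀ c b a, size (step c b a) ≤ size b + K.eval (size (c, a))) :
    PolyFun fun c => (l c).foldl (step c) (init c) := by
  obtain ⟨Qi, hQi⟩ := hi.size_le
  obtain ⟨Ql, hQl⟩ := hl.size_le
  refine foldl hi hl hs (Qi + Ql * K.comp (1 + .X + Ql)) fun c l' hl' => ?_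
  have h1 : ∀ l' : List α, (∀ a ∈ l', size a ≤ size (l c)) → ∀ b,
      size (l'.foldl (step c) b) ≤ size b + l'.length * K.eval (1 + size c + size (l c)) := by
    intro l'
    induction l' with
    | nil => simp
    | cons a l' ih =>
      intro hl' b
      have h2 := ih (fun a ha => hl' a (by simp [ha])) (step c b a)
      have h3 := hK c b a
      have h4 := eval_mono K (show size (c, a) ≤ 1 + size c + size (l c) by
        have := hl' a (by simp)
        simp only [size_pair]; omega)
      simp only [List.foldl_cons, List.length_cons, Nat.add_mul]
      omega
  refine (h1 l' (fun a ha => size_le_of_mem (hl'.subset ha)) _).trans ?_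
  have h2 := hQi c
  have h3 := hQl c
  have h4 : l'.length ≤ Ql.eval (size c) :=
    (hl'.length_le.trans (length_le_size _)).trans h3
  have h5 := Nat.mul_le_mul h4 (eval_mono K (show 1 + size c + size (l c) ≤
    1 + size c + Ql.eval (size c) by omega))
  simp
  omega

/-! ### Lists -/

theorem cons {f : γ → α} {g : γ → List α} (hf : PolyFun f) (hg : PolyFun g) :
    PolyFun fun c => f c :: g c :=
  (hf.pair hg).congr_enc fun _ => rfl

theorem listReverse {l : γ → List α} (hl : PolyFun l) : PolyFun fun c => (l c).reverse :=
  (foldl_of_le (step := fun _ b a => a :: b) (const []) hl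
    (cons (snd.comp snd) (fst.comp snd)) .X fun c b a => by simp; omega).congr
    fun c => by simp

theorem append {f g : γ → List α} (hf : PolyFun f) (hg : PolyFun g) :
    PolyFun fun c => f c ++ g c :=
  (foldl_of_le (step := fun _ b a => a :: b) hg hf.listReverse
    (cons (snd.comp snd) (fst.comp snd)) .X fun c b a => by simp; omega).congr
    fun c => by simp

theorem size_append (l l' : List α) : size (l ++ l') + 1 = size l + size l' := by
  induction l with
  | nil => simp; omega
  | cons a l ih => simp; omega

theorem flatMap {l : γ → List α} {g : γ → α → List β} (hl : PolyFun l)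
    (hg : PolyFun fun x : γ × α => g x.1 x.2) : PolyFun fun c => (l c).flatMap (g c) := by
  obtain ⟨Q, hQ⟩ := hg.size_le
  refine (foldl_of_le (step := fun c b a => b ++ g c a) (const []) hl
    (append (fst.comp snd) (hg.comp (fst.pair (snd.comp snd)))) Q fun c b a => ?_).congr
    fun c => ?_
  · have h1 := hQ (c, a)
    have h2 := size_append b (g c a)
    simp only at h1
    omega
  · generalize l c = l
    suffices ∀ b, l.foldl (fun b a => b ++ g c a) b = b ++ l.flatMap (g c) by simpa using this []
    induction l with
    | nil => simp
    | cons a l ih => simp [ih]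

theorem map {l : γ → List α} {g : γ → α → β} (hl : PolyFun l)
    (hg : PolyFun fun x : γ × α => g x.1 x.2) : PolyFun fun c => (l c).map (g c) :=
  (flatMap (g := fun c a => [g c a]) hl (hg.cons (const []))).congr fun c => by
    exact (List.map_eq_flatMap ..).symm

theorem filter {l : γ → List α} {P : γ → α → Prop} [∀ c, DecidablePred (P c)] (hl : PolyFun l)
    (hP : PolyFun fun x : γ × α => decide (P x.1 x.2)) :
    PolyFun fun c => (l c).filter fun a => P c a :=
  (flatMap (g := fun c a => if P c a then [a] else []) hl
    (ite hP (snd.cons (const [])) (const []))).congr fun c => by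
      induction l c with
      | nil => simp
      | cons a l ih => by_cases h : P c a <;> simp_all

theorem product {l : γ → List α} {l' : γ → List β} (hl : PolyFun l) (hl' : PolyFun l') :
    PolyFun fun c => l c ×ˢ l' c :=
  flatMap (g := fun c a => (l' c).map (Prod.mk a)) hl
    (map (g := fun (x : γ × α) b => (x.2, b)) (hl'.comp fst) ((snd.comp fst).pair snd))

/-! ### Equality and Boolean combinations -/

theorem not {P : γ → Prop} [DecidablePred P] (hP : PolyFun fun c => decide (P c)) :
    PolyFun fun c => decide (¬ P c) :=
  (ite hP (const false) (const true)).congr fun c => by by_cases h : P c <;> simp [h]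

theorem and {P Q : γ → Prop} [DecidablePred P] [DecidablePred Q]
    (hP : PolyFun fun c => decide (P c)) (hQ : PolyFun fun c => decide (Q c)) :
    PolyFun fun c => decide (P c ∧ Q c) :=
  (ite hP hQ (const false)).congr fun c => by by_cases h : P c <;> simp [h]

theorem or {P Q : γ → Prop} [DecidablePred P] [DecidablePred Q]
    (hP : PolyFun fun c => decide (P c)) (hQ : PolyFun fun c => decide (Q c)) :
    PolyFun fun c => decide (P c ∨ Q c) :=
  (ite hP (const true) hQ).congr fun c => by by_cases h : P c <;> simp [h]

end PolyFun

/-! ### Injective representations and case distinctions -/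

/-- Types in which different elements are represented by different trees. -/
class LawfulEnc (α : Type) [Enc α] : Prop where
  enc_inj : ∀ a b : α, enc a = enc b → a = b

instance : LawfulEnc Data := ⟨fun _ _ h => h⟩

instance : LawfulEnc Bool := ⟨fun a b h => by cases a <;> cases b <;> simp_all [enc]⟩

instance : LawfulEnc Γ' := ⟨fun a b h => by
  rcases a with _ | (_ | _) | _ | _ | _ <;> rcases b with _ | (_ | _) | _ | _ | _ <;>
    simp_all [enc]⟩

instance [LawfulEnc α] : LawfulEnc (List α) := ⟨fun a => by
  induction a with
  | nil => intro b h; cases b <;> simp_all [enc, encList]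
  | cons x a ih =>
    intro b h
    cases b with
    | nil => simp [enc, encList] at h
    | cons y b =>
      simp only [enc, encList, Data.node.injEq] at h
      rw [LawfulEnc.enc_inj _ _ h.1, ih _ h.2]⟩

/-- Numbers are represented in unary. -/
def encNat : ℕ → Data
  | 0 => .nil
  | n + 1 => .node .nil (encNat n)

instance : Enc ℕ := ⟨encNat⟩

instance : Enc Unit := ⟨fun _ => .nil⟩

instance : LawfulEnc ℕ := ⟨fun a => by
  induction a with
  | zero => intro b h; cases b <;> simp_all [enc, encNat]
  | succ a ih =>
    intro b h
    cases b with
    | zero => simp [enc, encNat] at h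
    | succ b =>
      simp only [enc, encNat, Data.node.injEq, true_and] at h
      rw [ih _ h]⟩

instance : Enc (Option α) := ⟨fun
  | none => .nil
  | some a => .node .nil (enc a)⟩

instance [LawfulEnc α] : LawfulEnc (Option α) := ⟨fun a b h => by
  cases a <;> cases b <;> simp_all [enc]
  exact LawfulEnc.enc_inj _ _ h⟩

@[simp] theorem size_none : size (none : Option α) = 1 := rfl

@[simp] theorem size_some (a : α) : size (some a) = 2 + size a := by
  simp [size, enc, Data.str]; omega

@[simp] theorem size_succ (n : ℕ) : size (n + 1) = 2 + size n := by
  simp [size, enc, encNat, Data.str]; omega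

namespace PolyFun

theorem eq [LawfulEnc β] [DecidableEq β] {f g : γ → β} (hf : PolyFun f) (hg : PolyFun g) :
    PolyFun fun c => decide (f c = g c) :=
  (eq_data.comp ((hf.congr_enc (g := fun c => enc (f c)) fun _ => rfl).pair
    (hg.congr_enc (g := fun c => enc (g c)) fun _ => rfl))).congr fun c => by
    simp only [decide_eq_decide]
    exact ⟨LawfulEnc.enc_inj _ _, fun h => h ▸ rfl⟩

theorem eq_nil {l : γ → List α} (hl : PolyFun l) [∀ c, Decidable (l c = [])] :
    PolyFun fun c => decide (l c = []) :=
  (eq_data.comp ((hl.congr_enc (g := fun c => enc (l c)) fun _ => rfl).pair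
    (const Data.nil))).congr fun c => by
    simp only [decide_eq_decide]
    rcases l c with _ | ⟨a, t⟩ <;> simp [enc, encList]

/-- The tree of `a :: t` is that of the pair `(a, t)`, so on nonempty lists taking the list apart is
a mere change of type. -/
theorem listCases {l : γ → List α} {f : γ → β} {g : γ → α → List α → β} (hl : PolyFun l)
    (hf : PolyFun f) (hg : PolyFun fun x : γ × α × List α => g x.1 x.2.1 x.2.2) :
    PolyFun fun c => match l c with
      | [] => f c
      | a :: t => g c a t := by
  classical
  have h1 : PolyFun (fun c : {c // ¬ l c = []} =>
      (c.1, (l c.1).head c.2, (l c.1).tail)) :=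
    ((id.pair hl).comp val).congr_enc fun c => by
      obtain ⟨a, t, h⟩ := List.exists_cons_of_ne_nil c.2
      simp only [h, List.head_cons, List.tail_cons]
      rfl
  refine (dite hl.eq_nil (hf.comp val) (hg.comp h1)).congr fun c => ?_
  split
  · split <;> simp_all
  · split <;> simp_all

/-- As for lists: the tree of `some a` is that of the pair `((), a)`. -/
theorem optionCases {o : γ → Option α} {f : γ → β} {g : γ → α → β} (ho : PolyFun o)
    (hf : PolyFun f) (hg : PolyFun fun x : γ × α => g x.1 x.2) :
    PolyFun fun c => match o c with
      | none => f c
      | some a => g c a := by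
  classical
  have h0 : PolyFun fun c => decide (o c = none) :=
    (eq_data.comp ((ho.congr_enc (g := fun c => enc (o c)) fun _ => rfl).pair
      (const Data.nil))).congr fun c => by
      simp only [decide_eq_decide]
      rcases o c with _ | a <;> simp [enc]
  have h1 : PolyFun (fun c : {c // ¬ o c = none} =>
      (c.1, (), (o c.1).get (Option.isSome_iff_ne_none.2 c.2))) :=
    ((id.pair ho).comp val).congr_enc fun c => by
      obtain ⟨a, h⟩ := Option.ne_none_iff_exists'.1 c.2
      simp only [h, Option.get_some]
      rfl
  refine (dite h0 (hf.comp val) (hg.comp ((fst.pair (snd.comp snd)).comp h1))).congr fun c => ?_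
  split
  · split <;> simp_all
  · split <;> simp_all

end PolyFun

end

section

variable {α β γ δ : Type} [Enc α] [Enc β] [Enc γ] [Enc δ]

namespace PolyFun

/-! ### Numbers -/

theorem succ {f : γ → ℕ} (hf : PolyFun f) : PolyFun fun c => f c + 1 :=
  ((const ()).pair hf).congr_enc fun _ => rfl

/-- A number in unary has the tree of a list of units. Arithmetic thereby reduces to operations on
lists. -/
theorem natUnits : PolyFun fun n : ℕ => List.replicate n () :=
  of_enc_eq fun n => by
    induction n with
    | zero => rfl
    | succ n ih =>
      change Data.node .nil (enc (List.replicate n ())) = Data.node .nil (enc n)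
      rw [ih]

theorem length {l : γ → List α} (hl : PolyFun l) : PolyFun fun c => (l c).length := by
  have h : PolyFun fun l : List Unit => l.length := of_enc_eq fun l => by
    induction l with
    | nil => rfl
    | cons a l ih =>
      change Data.node .nil (enc l.length) = Data.node .nil (enc l)
      rw [ih]
  exact (h.comp (map (g := fun _ _ => ()) hl (const ()))).congr fun c => by simp

theorem replicate {n : γ → ℕ} {f : γ → α} (hn : PolyFun n) (hf : PolyFun f) :
    PolyFun fun c => List.replicate (n c) (f c) :=
  (map (g := fun c _ => f c) (natUnits.comp hn) (hf.comp fst)).congr fun c => by simp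

theorem add {f g : γ → ℕ} (hf : PolyFun f) (hg : PolyFun g) : PolyFun fun c => f c + g c :=
  (length (append (natUnits.comp hf) (natUnits.comp hg))).congr fun c => by simp

theorem mul {f g : γ → ℕ} (hf : PolyFun f) (hg : PolyFun g) : PolyFun fun c => f c * g c :=
  (length (product (natUnits.comp hf) (natUnits.comp hg))).congr fun c => by
    simp [List.length_product]

theorem iterate {n : γ → ℕ} {init : γ → β} {step : γ → β → β} (hn : PolyFun n)
    (hi : PolyFun init) (hs : PolyFun fun x : γ × β => step x.1 x.2) (K : ℕ)
    (hK : ∀ c b, size (step c b) ≤ size b + K) : PolyFun fun c => (step c)^[n c] (init c) :=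
  (foldl_of_le (step := fun c b _ => step c b) hi (natUnits.comp hn)
    (hs.comp (fst.pair (fst.comp snd))) (.C K) fun c b _ => by simpa using hK c b).congr
    fun c => by
      generalize init c = b
      generalize n c = n
      induction n generalizing b with
      | zero => rfl
      | succ n ih => exact ih _

theorem tail {l : γ → List α} (hl : PolyFun l) : PolyFun fun c => (l c).tail :=
  (listCases (g := fun _ _ t => t) hl (const []) (snd.comp snd)).congr fun c => by
    cases l c <;> rfl

theorem headD {l : γ → List α} {f : γ → α} (hl : PolyFun l) (hf : PolyFun f) :
    PolyFun fun c => (l c).headD (f c) :=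
  (listCases (g := fun _ a _ => a) hl hf (fst.comp snd)).congr fun c => by
    cases l c <;> rfl

theorem sub {f g : γ → ℕ} (hf : PolyFun f) (hg : PolyFun g) : PolyFun fun c => f c - g c :=
  (length (iterate (step := fun _ => List.tail) hg (natUnits.comp hf) (tail snd) 0
    fun c b => by cases b <;> simp)).congr fun c => by
      generalize g c = n
      suffices ∀ l : List Unit, (List.tail^[n] l).length = l.length - n by simp [this]
      induction n with
      | zero => simp
      | succ n ih => intro l; rw [iterate_succ_apply, ih]; simp; omega

theorem le {f g : γ → ℕ} (hf : PolyFun f) (hg : PolyFun g) : PolyFun fun c => decide (f c ≤ g c) :=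
  ((hf.sub hg).eq (const 0)).congr fun c => by
    simp only [decide_eq_decide]
    omega

theorem lt {f g : γ → ℕ} (hf : PolyFun f) (hg : PolyFun g) : PolyFun fun c => decide (f c < g c) :=
  hf.succ.le hg

theorem min {f g : γ → ℕ} (hf : PolyFun f) (hg : PolyFun g) : PolyFun fun c => min (f c) (g c) :=
  (ite (hf.le hg) hf hg).congr fun c => by rw [min_def]

theorem optionToList {o : γ → Option α} (ho : PolyFun o) : PolyFun fun c => (o c).toList :=
  (optionCases (g := fun _ a => [a]) ho (const []) (snd.cons (const []))).congr fun c => by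
    cases o c <;> rfl

theorem some {f : γ → α} (hf : PolyFun f) : PolyFun fun c => Option.some (f c) :=
  ((const ()).pair hf).congr_enc fun _ => rfl

theorem mem [LawfulEnc α] [DecidableEq α] {f : γ → α} {l : γ → List α} (hf : PolyFun f)
    (hl : PolyFun l) : PolyFun fun c => decide (f c ∈ l c) := by
  refine (not (eq_nil (filter (P := fun c a => a = f c) hl (eq snd (hf.comp fst))))).congr
    fun c => ?_
  simp only [decide_eq_decide, List.filter_eq_nil_iff]
  simp

end PolyFun

end

theorem size_nat (n : ℕ) : size n = 2 * n + 1 := by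
  induction n with
  | zero => rfl
  | succ n ih => rw [size_succ, ih]; omega

/-! ### The auction algorithm for bipartite matchings -/

section Auction

variable {E T : Type} (C : T → E → Prop) [∀ t, DecidablePred (C t)]

/-- In the auction, every `t : T` has a price and possibly an owner in `E`. -/
abbrev Entry (E T : Type) := T × ℕ × Option E

/-- The entry `e` is cheaper than the entry `o`, if any. -/
def Cheaper (e : Entry E T) (o : Option (Entry E T)) : Prop := ∀ e' ∈ o, e.2.1 < e'.2.1

instance (e : Entry E T) (o : Option (Entry E T)) : Decidable (Cheaper e o) :=
  inferInstanceAs (Decidable (∀ e' ∈ o, e.2.1 < e'.2.1))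

/-- Compare the best entry found so far with the entry `e`. -/
def selectStep (l : E) (acc : Option (Entry E T) × List (Entry E T)) (e : Entry E T) :
    Option (Entry E T) × List (Entry E T) :=
  if C e.1 l ∧ Cheaper e acc.1 then (some e, acc.1.toList ++ acc.2) else (acc.1, e :: acc.2)

/-- Split off a cheapest entry among those that `l` may own. -/
def select (l : E) (rs : List (Entry E T)) : Option (Entry E T) × List (Entry E T) :=
  rs.foldl (selectStep C l) (none, [])

/-- The element `l` buys the entry `e` and the former owner has to wait. -/
def buy (l : E) (q : List E) (e : Entry E T) (others : List (Entry E T)) :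
    List E × List (Entry E T) :=
  (e.2.2.toList ++ q, (e.1, e.2.1 + 1, some l) :: others)

/-- One round of the auction: the first waiting element buys a cheapest entry that it may own,
unless its price has reached `n`. -/
def auctionStep (n : ℕ) (s : List E × List (Entry E T)) : List E × List (Entry E T) :=
  match s.1 with
  | [] => s
  | l :: q =>
    match (select C l s.2).1 with
    | none => s
    | some e => if n ≤ e.2.1 then s else buy l q e (select C l s.2).2

/-- The auction for the elements of `L` with the goods `ts`. -/
def auction (L : List E) (ts : List T) : List E × List (Entry E T) :=
  (auctionStep C L.length)^[ts.length * L.length + 1] (L, ts.map fun t => (t, 0, none))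

variable [Enc E] [Enc T]

/-- Selection only moves entries around. The summand `1` is the list node of the entry that is split
off. -/
theorem size_select (l : E) (rs : List (Entry E T)) :
    ((select C l rs).1.elim 0 fun e => 1 + size e) + size (select C l rs).2 = size rs := by
  suffices ∀ acc : Option (Entry E T) × List (Entry E T),
      ((rs.foldl (selectStep C l) acc).1.elim 0 fun e => 1 + size e) +
        size (rs.foldl (selectStep C l) acc).2 + 1 =
      (acc.1.elim 0 fun e => 1 + size e) + size acc.2 + size rs by
    have := this (none, [])
    simp only [Option.elim_none, size_nil] at this
    unfold select
    omega
  induction rs with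
  | nil => intro acc; simp
  | cons e rs ih =>
    intro acc
    rw [List.foldl_cons, ih, size_cons]
    obtain ⟨o, os⟩ := acc
    unfold selectStep
    split_ifs
    · cases o <;> simp <;> omega
    · simp; omega

/-- A purchase moves one element out of the queue and at most one back, and increases one unary
price by one. The growth is thus bounded by a constant, which `PolyFun.iterate` requires. -/
theorem size_auctionStep (n : ℕ) (s : List E × List (Entry E T)) :
    size (auctionStep C n s) ≤ size s + 10 := by
  obtain ⟨q, rs⟩ := s
  unfold auctionStep
  split
  · omega
  · next l q' h =>
    simp only at h
    subst h
    split
    · omega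
    · next e he =>
      split_ifs
      · omega
      · have h1 := size_select C l rs
        simp only at he
        rw [he] at h1
        obtain ⟨t, p, o⟩ := e
        unfold buy
        cases o <;> simp at * <;> omega

/-! ### Polynomial time of the auction -/

variable {C}

namespace PolyFun

theorem cheaper : PolyFun fun x : Entry E T × Option (Entry E T) => decide (Cheaper x.1 x.2) :=
  (optionCases (o := fun x : Entry E T × Option (Entry E T) => x.2)
    (g := fun x e' => decide (x.1.2.1 < e'.2.1)) snd (const true)
    (lt (fst.comp (snd.comp (fst.comp fst))) (fst.comp (snd.comp snd)))).congr fun x => by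
      obtain ⟨e, _ | e'⟩ := x <;> simp [Cheaper]

theorem select (hC : PolyFun fun x : T × E => decide (C x.1 x.2)) :
    PolyFun fun x : E × List (Entry E T) => select C x.1 x.2 := by
  refine foldl_of_le (init := fun _ => (none, [])) (step := fun x => selectStep C x.1) (const _)
    snd ?_ (3 * .X) ?_
  · have he : PolyFun fun x : (E × List (Entry E T)) ×
        (Option (Entry E T) × List (Entry E T)) × Entry E T => x.2.2 := snd.comp snd
    have hb : PolyFun fun x : (E × List (Entry E T)) ×
        (Option (Entry E T) × List (Entry E T)) × Entry E T => x.2.1.1 :=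
      fst.comp (fst.comp snd)
    have ho : PolyFun fun x : (E × List (Entry E T)) ×
        (Option (Entry E T) × List (Entry E T)) × Entry E T => x.2.1.2 :=
      snd.comp (fst.comp snd)
    exact ite (and (hC.comp ((fst.comp he).pair (fst.comp fst))) (cheaper.comp (he.pair hb)))
      ((some he).pair (append (optionToList hb) ho)) (hb.pair (he.cons ho))
  · rintro ⟨l, rs⟩ ⟨o, os⟩ e
    unfold selectStep
    have := size_append o.toList os
    split_ifs
    · cases o <;> simp at * <;> omega
    · simp; omega

theorem auctionStep (hC : PolyFun fun x : T × E => decide (C x.1 x.2)) :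
    PolyFun fun x : ℕ × List E × List (Entry E T) => auctionStep C x.1 x.2 := by
  have hsel : PolyFun fun x : (ℕ × List E × List (Entry E T)) × E × List E =>
      PossibleIndependence.select C x.2.1 x.1.2.2 :=
    (select hC).comp ((fst.comp snd).pair (snd.comp (snd.comp fst)))
  refine listCases (l := fun x : ℕ × List E × List (Entry E T) => x.2.1) (f := fun x => x.2)
    (g := fun x l q =>
      match (PossibleIndependence.select C l x.2.2).1 with
      | none => x.2
      | .some e => if x.1 ≤ e.2.1 then x.2 else
        buy l q e (PossibleIndependence.select C l x.2.2).2) (fst.comp snd) snd ?_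
  refine (optionCases (o := fun x : (ℕ × List E × List (Entry E T)) × E × List E =>
      (PossibleIndependence.select C x.2.1 x.1.2.2).1) (f := fun x => x.1.2)
    (g := fun x e => if x.1.1 ≤ e.2.1 then x.1.2 else
      buy x.2.1 x.2.2 e (PossibleIndependence.select C x.2.1 x.1.2.2).2)
    (fst.comp hsel) (snd.comp fst) ?_).congr fun x => by
      cases (PossibleIndependence.select C x.2.1 x.1.2.2).1 <;> rfl
  have he : PolyFun fun x : ((ℕ × List E × List (Entry E T)) × E × List E) × Entry E T => x.2 := snd
  refine ite (le (fst.comp (fst.comp fst)) (fst.comp (snd.comp snd))) (snd.comp (fst.comp fst))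
    (pair (append (optionToList (snd.comp (snd.comp he))) (snd.comp (snd.comp fst)))
      (cons (pair (fst.comp he) (pair (succ (fst.comp (snd.comp he)))
        (some (fst.comp (snd.comp fst))))) ((snd.comp hsel).comp fst)))

theorem auction (hC : PolyFun fun x : T × E => decide (C x.1 x.2)) :
    PolyFun fun x : List E × List T => auction C x.1 x.2 :=
  iterate (step := fun x : List E × List T => PossibleIndependence.auctionStep C x.1.length)
    (succ (mul (length snd) (length fst)))
    (pair fst (map (g := fun _ t => (t, 0, none)) snd (pair snd (const (0, none)))))
    ((auctionStep hC).comp (pair (length (fst.comp fst)) snd)) 10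
    fun _ b => size_auctionStep C _ b

end PolyFun

end Auction

/-! ### Correctness of the auction -/

section Auction

variable {E T : Type} (C : T → E → Prop) [∀ t, DecidablePred (C t)]

theorem select_append (l : E) (rs : List (Entry E T)) (e : Entry E T) :
    select C l (rs ++ [e]) = selectStep C l (select C l rs) e := by
  simp [select]

theorem select_perm (l : E) (rs : List (Entry E T)) :
    ((select C l rs).1.toList ++ (select C l rs).2).Perm rs := by
  induction rs using List.reverseRecOn with
  | nil => simp [select]
  | append_singleton rs e ih =>
    rw [select_append]
    refine List.Perm.trans ?_ ((ih.cons e).trans (List.perm_append_singleton e rs).symm)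
    unfold selectStep
    split_ifs
    · simp
    · exact List.perm_middle

theorem select_spec (l : E) (rs : List (Entry E T)) :
    (∀ e ∈ (select C l rs).1, C e.1 l) ∧
      ∀ e' ∈ rs, C e'.1 l → ∃ e ∈ (select C l rs).1, e.2.1 ≤ e'.2.1 := by
  induction rs using List.reverseRecOn with
  | nil => simp [select]
  | append_singleton rs e ih =>
    rw [select_append]
    generalize select C l rs = acc at *
    obtain ⟨h1, h2⟩ := ih
    unfold selectStep
    split_ifs with h
    · refine ⟨by simpa using h.1, fun e' he' hC => ?_⟩
      refine ⟨e, rfl, ?_⟩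
      rcases List.mem_append.1 he' with he' | he'
      · obtain ⟨e'', h3, h4⟩ := h2 e' he' hC
        exact (h.2 e'' h3).le.trans h4
      · rw [List.mem_singleton.1 he']
    · refine ⟨h1, fun e' he' hC => ?_⟩
      rcases List.mem_append.1 he' with he' | he'
      · exact h2 e' he' hC
      · obtain rfl := List.mem_singleton.1 he'
        simp only [Cheaper, not_and, not_forall, not_lt] at h
        obtain ⟨e'', h3, h4⟩ := h hC
        exact ⟨e'', h3, h4⟩

/-- The owners of the entries. -/
def owners (rs : List (Entry E T)) : List E := rs.filterMap fun e => e.2.2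

/-- The invariant of the auction. -/
structure AuctionInv (L : List E) (ts : List T) (s : List E × List (Entry E T)) : Prop where
  perm_goods : (s.2.map Prod.fst).Perm ts
  perm_owners : (s.1 ++ owners s.2).Perm L
  price_eq_zero : ∀ e ∈ s.2, e.2.2 = none → e.2.1 = 0
  compat : ∀ e ∈ s.2, ∀ l ∈ e.2.2, C e.1 l
  slack : ∀ e ∈ s.2, ∀ l ∈ e.2.2, ∀ e' ∈ s.2, C e'.1 l → e.2.1 ≤ e'.2.1 + 1
  price_le : ∀ e ∈ s.2, e.2.1 ≤ L.length

/-- No waiting element can buy anything. -/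
def Stuck (n : ℕ) (s : List E × List (Entry E T)) : Prop :=
  ∀ l ∈ s.1.head?, ∀ e ∈ s.2, C e.1 l → n ≤ e.2.1

/-- If the cheapest compatible entry has already reached price `n`, so have all compatible ones;
hence a round without a purchase means that the state is stuck. -/
theorem auctionStep_eq (n : ℕ) (s : List E × List (Entry E T)) :
    (auctionStep C n s = s ∧ Stuck C n s) ∨
      ∃ l q e rs, s.1 = l :: q ∧ (e :: rs).Perm s.2 ∧ C e.1 l ∧
        (∀ e' ∈ s.2, C e'.1 l → e.2.1 ≤ e'.2.1) ∧ e.2.1 < n ∧ auctionStep C n s = buy l q e rs := by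
  unfold auctionStep
  split
  · next h => exact .inl ⟨rfl, by simp [Stuck, h]⟩
  · next l q h =>
    have h1 := select_spec C l s.2
    have h2 := select_perm C l s.2
    split
    · next h3 =>
      refine .inl ⟨rfl, ?_⟩
      rw [h3] at h1
      intro l' hl' e he hC
      obtain rfl : l = l' := by simpa [h] using hl'
      obtain ⟨_, h4, _⟩ := h1.2 e he hC
      cases h4
    · next e h3 =>
      rw [h3] at h1 h2
      have h4 : ∀ e' ∈ s.2, C e'.1 l → e.2.1 ≤ e'.2.1 := fun e' he' hC => by
        obtain ⟨_, h4, h5⟩ := h1.2 e' he' hC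
        cases h4
        exact h5
      split_ifs with h5
      · refine .inl ⟨rfl, ?_⟩
        intro l' hl' e' he' hC
        obtain rfl : l = l' := by simpa [h] using hl'
        exact h5.trans (h4 e' he' hC)
      · exact .inr ⟨l, q, e, _, h, h2, h1.1 e rfl, h4, not_le.1 h5, rfl⟩

variable {C}

omit [∀ t, DecidablePred (C t)] in
-- Slack survives for two reasons: the buyer took a cheapest entry, whose price then rose by only
-- one, and for all other owners no price has fallen. An entry once bought is never without an owner
-- again, so entries without owner keep price zero.
theorem AuctionInv.buy {L : List E} {ts : List T} {s : List E × List (Entry E T)}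
    (h : AuctionInv C L ts s) {l : E} {q : List E} {e : Entry E T} {rs : List (Entry E T)}
    (hs : s.1 = l :: q) (hp : (e :: rs).Perm s.2) (hC : C e.1 l)
    (he : ∀ e' ∈ s.2, C e'.1 l → e.2.1 ≤ e'.2.1) (hn : e.2.1 < L.length) :
    AuctionInv C L ts (buy l q e rs) := by
  have hmem : ∀ e', e' ∈ s.2 ↔ e' = e ∨ e' ∈ rs := fun e' => by
    rw [← hp.mem_iff, List.mem_cons]
  simp only [hmem, forall_eq_or_imp] at he
  refine ⟨?_, ?_, ?_, ?_, ?_, ?_⟩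
  · exact (hp.map Prod.fst).trans h.perm_goods
  · refine List.Perm.trans ?_ h.perm_owners
    rw [hs]
    refine List.Perm.trans ?_ ((hp.filterMap fun e => e.2.2).append_left (l :: q))
    obtain ⟨t, p, _ | l'⟩ := e
    · simp only [PossibleIndependence.buy, owners, List.filterMap_cons, Option.toList_none,
        List.nil_append]
      exact List.perm_middle
    · simp only [PossibleIndependence.buy, owners, List.filterMap_cons, Option.toList_some,
        List.cons_append]
      refine (List.Perm.cons l' List.perm_middle).trans ((List.Perm.swap l l' _).trans ?_)
      exact (List.perm_middle.symm).cons l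
  · have := h.price_eq_zero
    simp only [hmem, forall_eq_or_imp] at this
    simpa [PossibleIndependence.buy] using fun t p o => this.2 (t, p, o)
  · have := h.compat
    simp only [hmem, forall_eq_or_imp] at this
    intro e' he'
    rcases List.mem_cons.1 he' with rfl | he'
    · simpa using hC
    · exact this.2 e' he'
  · have := h.slack
    simp only [hmem, forall_eq_or_imp] at this
    intro e₁ he₁ l₁ hl₁ e₂ he₂ hC₂
    rcases List.mem_cons.1 he₁ with rfl | he₁
    · obtain rfl : l = l₁ := by simpa using hl₁
      rcases List.mem_cons.1 he₂ with rfl | he₂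
      · simp
      · simpa using he.2 e₂ he₂ hC₂
    · rcases List.mem_cons.1 he₂ with rfl | he₂
      · exact ((this.2 e₁ he₁ l₁ hl₁).1 hC₂).trans (by simp)
      · exact (this.2 e₁ he₁ l₁ hl₁).2 e₂ he₂ hC₂
  · have := h.price_le
    simp only [hmem, forall_eq_or_imp] at this
    intro e' he'
    rcases List.mem_cons.1 he' with rfl | he'
    · exact hn
    · exact this.2 e' he'

theorem AuctionInv.step {L : List E} {ts : List T} {s : List E × List (Entry E T)}
    (h : AuctionInv C L ts s) : AuctionInv C L ts (auctionStep C L.length s) := by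
  rcases auctionStep_eq C L.length s with h1 | ⟨l, q, e, rs, h1, h2, h3, h4, h5, h6⟩
  · rwa [h1.1]
  · rw [h6]
    exact h.buy h1 h2 h3 h4 h5

/-- The sum of all prices. -/
def totalPrice (s : List E × List (Entry E T)) : ℕ := (s.2.map fun e => e.2.1).sum

/-- Every purchase raises the total price by exactly one, so the total counts the rounds until the
auction is stuck. From then on nothing changes. -/
theorem auctionInv_iterate {L : List E} {ts : List T} (k : ℕ) :
    let s := (auctionStep C L.length)^[k] (L, ts.map fun t => (t, 0, none))
    AuctionInv C L ts s ∧ (Stuck C L.length s ∨ totalPrice s = k) := by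
  induction k with
  | zero =>
    refine ⟨⟨?_, ?_, ?_, ?_, ?_, ?_⟩, .inr ?_⟩
    · simp [Function.comp_def]
    · have : ts.filterMap (fun _ => (none : Option E)) = [] := by simp
      simp [owners, List.filterMap_map, this]
    all_goals simp [totalPrice, Function.comp_def]
  | succ k ih =>
    intro s
    have hs : s = auctionStep C L.length ((auctionStep C L.length)^[k] _) :=
      iterate_succ_apply' ..
    generalize (auctionStep C L.length)^[k] (L, ts.map fun t => (t, 0, none)) = s₀ at *
    obtain ⟨ih1, ih2⟩ := ih
    refine ⟨hs ▸ ih1.step, ?_⟩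
    rcases auctionStep_eq C L.length s₀ with h1 | ⟨l, q, e, rs, h1, h2, h3, h4, h5, h6⟩
    · rw [h1.1] at hs
      exact .inl (hs ▸ h1.2)
    · rcases ih2 with ih2 | ih2
      · have := ih2 l (by simp [h1]) e (h2.subset (by simp)) h3
        omega
      · refine .inr ?_
        rw [hs, h6, ← ih2]
        have := (h2.map fun e => e.2.1).sum_eq
        simp only [totalPrice, ← this, PossibleIndependence.buy, List.map_cons, List.sum_cons]
        omega

/-- The total price never exceeds `ts.length * L.length`, and the auction runs for one round more
than that. -/
theorem auction_inv (L : List E) (ts : List T) :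
    AuctionInv C L ts (auction C L ts) ∧ Stuck C L.length (auction C L ts) := by
  obtain ⟨h1, h2⟩ := auctionInv_iterate (C := C) (L := L) (ts := ts) (ts.length * L.length + 1)
  replace h1 : AuctionInv C L ts (auction C L ts) := h1
  refine ⟨h1, h2.resolve_right fun h3 => ?_⟩
  have h4 : totalPrice (auction C L ts) ≤ _ :=
    List.sum_le_card_nsmul ((auction C L ts).2.map fun e => e.2.1) L.length
      (by simpa using fun p t o h => h1.price_le _ h)
  have h5 := h1.perm_goods.length_eq
  rw [List.length_map] at h4 h5
  change (auction C L ts).2.length = _ at h5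
  rw [h5, smul_eq_mul] at h4
  change totalPrice (auction C L ts) = _ at h3
  omega

theorem length_filter_owners_le {p : E → Prop} [DecidablePred p] {P : Entry E T → Prop}
    [DecidablePred P] (rs : List (Entry E T)) (h : ∀ e ∈ rs, ∀ l ∈ e.2.2, p l → P e) :
    ((owners rs).filter p).length ≤ rs.countP P := by
  induction rs with
  | nil => simp [owners]
  | cons e rs ih =>
    have ih := ih fun e he => h e (by simp [he])
    have h := h e (by simp)
    obtain ⟨t, k, _ | l⟩ := e
    · simp only [owners, List.filterMap_cons, List.countP_cons] at ih ⊢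
      omega
    · simp only [owners, List.filterMap_cons, List.countP_cons, List.filter_cons] at ih ⊢
      have := h l rfl
      split_ifs <;> (simp_all; try omega)

theorem length_owners {rs : List (Entry E T)} (h : ∀ e ∈ rs, e.2.2 ≠ none) :
    (owners rs).length = rs.length := by
  induction rs with
  | nil => rfl
  | cons e rs ih =>
    have ih := ih fun e he => h e (by simp [he])
    have h := h e (by simp)
    obtain ⟨t, k, _ | l⟩ := e
    · simp at h
    · simpa [owners] using ih

/-! ### The auction decides Hall's condition -/

variable [DecidableEq E]

/-- The condition of Hall's marriage theorem. -/
def HallCondition (C : T → E → Prop) [∀ t, DecidablePred (C t)] (L : Finset E) (ts : List T) :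
    Prop :=
  ∀ W ⊆ L, W.card ≤ ts.countP fun t => ∃ l ∈ W, C t l

/-- When nobody waits, ownership is a matching: the elements of `W` own distinct compatible goods.
-/
theorem hallCondition_of_auction {L : List E} (hL : L.Nodup) {ts : List T}
    (h : (auction C L ts).1 = []) : HallCondition C L.toFinset ts := by
  intro W hW
  have hinv := (auction_inv (C := C) L ts).1
  have ho := hinv.perm_owners
  rw [h, List.nil_append] at ho
  rw [← hinv.perm_goods.countP_eq, List.countP_map]
  have h1 : ((owners (auction C L ts).2).filter (· ∈ W)).toFinset = W := by
    ext l
    simp only [List.mem_toFinset, List.mem_filter, decide_eq_true_eq, ho.mem_iff]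
    exact ⟨fun h => h.2, fun h => ⟨List.mem_toFinset.1 (hW h), h⟩⟩
  rw [← h1, List.toFinset_card_of_nodup ((ho.nodup_iff.2 hL).filter _)]
  exact length_filter_owners_le _ fun e he l hl hlW => by
    rw [h1]
    simpa using ⟨l, hlW, hinv.compat e he l hl⟩

/-- Suppose that `l` is left waiting. Fewer than `L.length` goods are owned, so some price `k`
between `1` and `L.length` does not occur. The owners of the goods dearer than `k`, together with
`l`, are compatible only with goods dearer than `k`, and there is one good too few for them. -/
theorem auction_of_hallCondition {L : List E} (hL : L.Nodup) {ts : List T}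
    (hH : HallCondition C L.toFinset ts) : (auction C L ts).1 = [] := by
  obtain ⟨hinv, hst⟩ := auction_inv (C := C) L ts
  generalize auction C L ts = s at *
  by_contra hq
  obtain ⟨l, q, hq⟩ := List.exists_cons_of_ne_nil hq
  have hnd : (s.1 ++ owners s.2).Nodup := hinv.perm_owners.nodup_iff.2 hL
  have hlen := hinv.perm_owners.length_eq
  rw [hq, List.length_append, List.length_cons] at hlen
  have howned : ∀ e ∈ s.2, 0 < e.2.1 → e.2.2 ≠ none := fun e he h0 hn => by
    have := hinv.price_eq_zero e he hn
    omega
  -- If all these prices occurred, there would be `L.length` goods of positive price, all owned,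
  -- although `l` owns none.
  obtain ⟨k, hk1, hkn, hk⟩ : ∃ k, 1 ≤ k ∧ k ≤ L.length ∧ ∀ e ∈ s.2, e.2.1 ≠ k := by
    by_contra hcon
    push Not at hcon
    have h1 : Finset.Icc 1 L.length ⊆
        ((s.2.filter fun e => 0 < e.2.1).map fun e => e.2.1).toFinset := fun k hk => by
      rw [Finset.mem_Icc] at hk
      obtain ⟨e, he, rfl⟩ := hcon k hk.1 hk.2
      simp only [List.mem_toFinset, List.mem_map, List.mem_filter, decide_eq_true_eq]
      exact ⟨e, ⟨he, by omega⟩, rfl⟩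
    have h2 := (Finset.card_le_card h1).trans (List.toFinset_card_le _)
    rw [Nat.card_Icc, List.length_map, ← length_owners fun e he => by
      rw [List.mem_filter] at he
      exact howned e he.1 (by simpa using he.2)] at h2
    have h3 : (owners (s.2.filter fun e => 0 < e.2.1)).length ≤ (owners s.2).length :=
      (List.filter_sublist.filterMap _).length_le
    omega
  set O := owners (s.2.filter fun e => k < e.2.1) with hO
  have hOs : O.Sublist (owners s.2) := List.filter_sublist.filterMap _
  have hlO : l ∉ O := fun h => by
    rw [hq, List.cons_append, List.nodup_cons] at hnd
    exact hnd.1 (List.mem_append_right _ (hOs.subset h))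
  have hcard : (insert l O.toFinset).card = (s.2.filter fun e => k < e.2.1).length + 1 := by
    rw [Finset.card_insert_of_notMem (by simpa using hlO),
      List.toFinset_card_of_nodup ((List.nodup_append.1 hnd).2.1.sublist hOs), hO, length_owners]
    intro e he
    rw [List.mem_filter] at he
    have : k < e.2.1 := by simpa using he.2
    exact howned e he.1 (by omega)
  have hW := hH (insert l O.toFinset) fun x hx => by
    rw [List.mem_toFinset, ← hinv.perm_owners.mem_iff, hq]
    rcases Finset.mem_insert.1 hx with rfl | hx
    · simp
    · exact List.mem_append_right _ (hOs.subset (List.mem_toFinset.1 hx))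
  rw [hcard, ← hinv.perm_goods.countP_eq, List.countP_map, ← List.countP_eq_length_filter] at hW
  -- Every good compatible with the violating set costs at least `k`: for `l` because the auction is
  -- stuck, for an owner by slack, since the owned good costs at least `k + 1`. As `k` is not a
  -- price, such a good costs more than `k`.
  refine absurd (hW.trans (List.countP_mono_left fun e he h => ?_)) (Nat.lt_irrefl _)
  simp only [Function.comp_apply, decide_eq_true_eq, Finset.mem_insert, List.mem_toFinset] at h ⊢
  suffices k ≤ e.2.1 from lt_of_le_of_ne this (hk e he).symm
  obtain ⟨w, rfl | hw, hC⟩ := h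
  · exact hkn.trans (hst w (by simp [hq]) e he hC)
  · obtain ⟨e', he', hw⟩ := List.mem_filterMap.1 hw
    rw [List.mem_filter] at he'
    have h1 : k < e'.2.1 := by simpa using he'.2
    have h2 := hinv.slack e' he'.1 w hw e he hC
    omega

theorem auction_eq_nil_iff {L : List E} (hL : L.Nodup) (ts : List T) :
    (auction C L ts).1 = [] ↔ HallCondition C L.toFinset ts :=
  ⟨hallCondition_of_auction hL, auction_of_hallCondition hL⟩

end Auction

/-! ### Unary possible independence atoms and matchings -/

section Semantics

variable {Att Val N : Type} {R : Schema Att Val}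

/-- A pair of cells can be completed to the pair `l`. -/
def Covers (t l : Option N × Option N) : Prop :=
  (t.1 = none ∨ t.1 = l.1) ∧ (t.2 = none ∨ t.2 = l.2)

instance [DecidableEq N] (t : Option N × Option N) : DecidablePred (Covers t) :=
  fun _ => inferInstanceAs (Decidable (_ ∧ _))

/-- `S` consists of the non-null cells in `l`, or only of the null cell if there are none. -/
def IsSide (S : Finset (Option N)) (l : List (Option N)) : Prop :=
  ∀ x, x ∈ S ↔ (x ≠ none ∧ x ∈ l) ∨ (x = none ∧ ∀ y ∈ l, y = none)

theorem IsSide.nonempty {S : Finset (Option N)} {l : List (Option N)} (h : IsSide S l) :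
    ∃ x, x ∈ S := by
  by_cases hl : ∀ y ∈ l, y = none
  · exact ⟨none, (h none).2 (.inr ⟨rfl, hl⟩)⟩
  · push Not at hl
    obtain ⟨y, hy, hn⟩ := hl
    exact ⟨y, (h y).2 (.inl ⟨hn, hy⟩)⟩

theorem IsSide.mem_of_ne_none {S : Finset (Option N)} {l : List (Option N)} (h : IsSide S l)
    {x : Option N} (hx : x ∈ l) (hn : x ≠ none) : x ∈ S := (h x).2 (.inl ⟨hn, hx⟩)

theorem countP_le_of_rel {α β : Type*} {P : α → β → Prop} {s : Multiset α} {t : Multiset β}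
    (h : Multiset.Rel P s t) {p : α → Prop} {q : β → Prop} [DecidablePred p] [DecidablePred q]
    (hpq : ∀ a ∈ s, ∀ b ∈ t, P a b → q b → p a) : t.countP q ≤ s.countP p := by
  induction h with
  | zero => simp
  | @cons a b as bs hab _ ih =>
    have ih := ih fun a ha b hb => hpq a (by simp [ha]) b (by simp [hb])
    have := hpq a (by simp) b (by simp) hab
    rw [Multiset.countP_cons, Multiset.countP_cons]
    split_ifs <;> first | omega | tauto

theorem exists_rel_left {α β : Type*} {P : α → β → Prop} {s : Multiset α} {t : Multiset β}
    (h : Multiset.Rel P s t) {a : α} (ha : a ∈ s) : ∃ b ∈ t, P a b :=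
  Multiset.exists_mem_of_rel_of_mem h ha

/-- The name of the entry of a tuple. -/
def cellOf (nm : Val → N) (A : R.attrs) (t : R.Row) : Option N := (t A).map nm

section Hall

variable [DecidableEq N] {nm : Val → N} {r r' : Relation R} {A B : R.attrs}
  {ts : List R.Row} {SA SB : Finset (Option N)}

/-- Send every value that is not the name of an element of `S` to a default element of `S`. -/
noncomputable def retract (S : Finset (Option N)) (x : Option N) : Option N :=
  open Classical in if x ∈ S then x else if h : S.Nonempty then h.choose else none

/-- A value occurring in the relation survives grounding. The placeholder belongs to `SA` only if it
is its sole element, and then any grounded tuple is sent to it; this needs a tuple to exist. -/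
theorem exists_retract_eq (hr : r.tuples = ts) (hg : r.IsGrounding r') (hts : ts ≠ [])
    (hS : IsSide SA (ts.map (cellOf nm A))) {a : Option N} (ha : a ∈ SA) :
    ∃ t' ∈ r'.tuples, retract SA (cellOf nm A t') = a := by
  rcases (hS a).1 ha with ⟨hn, h⟩ | ⟨rfl, h⟩
  · obtain ⟨t, ht, rfl⟩ := List.mem_map.1 h
    obtain ⟨t', ht', hgt⟩ := exists_rel_left hg (a := t) (by simpa [hr] using ht)
    refine ⟨t', ht', ?_⟩
    have hA : t A ≠ none := fun h => hn (by simp [cellOf, h])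
    rw [cellOf, hgt.2.2 A hA]
    exact if_pos ha
  · obtain ⟨t, ts', rfl⟩ := List.exists_cons_of_ne_nil hts
    obtain ⟨t', ht', hgt⟩ := exists_rel_left hg (a := t) (by simp [hr])
    refine ⟨t', ht', ?_⟩
    have hall : ∀ x ∈ SA, x = none := fun x hx => by
      rcases (hS x).1 hx with h' | h'
      · exact h x h'.2
      · exact h'.1
    unfold retract
    split_ifs with h1 h2
    · exact hall _ h1
    · exact hall _ h2.choose_spec
    · rfl

theorem covers_retract (hS : IsSide SA (ts.map (cellOf nm A))) {t t' : R.Row} (ht : t ∈ ts)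
    (hg : R.IsTupleGrounding t t') :
    cellOf nm A t = none ∨ cellOf nm A t = retract SA (cellOf nm A t') := by
  by_cases hA : t A = none
  · exact .inl (by simp [cellOf, hA])
  · refine .inr ?_
    have h : cellOf nm A t ∈ SA :=
      hS.mem_of_ne_none (List.mem_map_of_mem ht) (by simpa [cellOf] using hA)
    rw [show cellOf nm A t' = cellOf nm A t by rw [cellOf, hg.2.2 A hA, cellOf]]
    exact (if_pos h).symm

/-- By independence, the retracted pairs of the grounded tuples exhaust `SA ×ˢ SB`, and each
grounded tuple whose retracted pair lies in `W` comes from its own tuple copy compatible with that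
pair. -/
theorem hallCondition_of_satisfies (hr : r.tuples = ts) (hts : ts ≠ [])
    (hA : IsSide SA (ts.map (cellOf nm A))) (hB : IsSide SB (ts.map (cellOf nm B)))
    (h : r.Satisfies ⟨{(A : Att)}, {(B : Att)}⟩) :
    HallCondition Covers (SA ×ˢ SB) (ts.map fun t => (cellOf nm A t, cellOf nm B t)) := by
  obtain ⟨r', hg, -, hind⟩ := h
  intro W hW
  set φ : R.Row → Option N × Option N := fun t =>
    (retract SA (cellOf nm A t), retract SB (cellOf nm B t)) with hφ
  have hsurj : ∀ w ∈ W, ∃ t ∈ r'.tuples, φ t = w := fun w hw => by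
    obtain ⟨ha, hb⟩ := Finset.mem_product.1 (hW hw)
    obtain ⟨t₁, ht₁, h₁⟩ := exists_retract_eq hr hg hts hA ha
    obtain ⟨t₂, ht₂, h₂⟩ := exists_retract_eq hr hg hts hB hb
    obtain ⟨t, ht, h3, h4⟩ := hind t₁ ht₁ t₂ ht₂
    refine ⟨t, ht, Prod.ext ?_ ?_⟩
    · rw [← h₁]
      simp only [hφ, cellOf, h3 A (by simp)]
    · rw [← h₂]
      simp only [hφ, cellOf, h4 B (by simp)]
  have h1 : W ⊆ ((r'.tuples.filter fun t => φ t ∈ W).map φ).toFinset := fun w hw => by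
    obtain ⟨t, ht, rfl⟩ := hsurj w hw
    exact Multiset.mem_toFinset.2 (Multiset.mem_map_of_mem φ (Multiset.mem_filter.2 ⟨ht, hw⟩))
  have h2 := (Finset.card_le_card h1).trans (Multiset.toFinset_card_le _)
  rw [Multiset.card_map, ← Multiset.countP_eq_card_filter] at h2
  refine h2.trans ((countP_le_of_rel hg (p := fun t => ∃ l ∈ W,
    Covers (cellOf nm A t, cellOf nm B t) l) ?_).trans ?_)
  · intro t ht t' ht' hgt hw
    rw [hr, Multiset.mem_coe] at ht
    exact ⟨_, hw, covers_retract hA ht hgt, covers_retract hB ht hgt⟩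
  · rw [hr, Multiset.coe_countP, List.countP_map]
    rfl

theorem countP_eq_card {α : Type*} (l : List α) (p : α → Prop) [DecidablePred p] :
    l.countP p = (Finset.univ.filter fun i : Fin l.length => p l[i]).card := by
  conv_lhs => rw [← List.ofFn_getElem (xs := l)]
  rw [← Multiset.coe_countP, ← Fin.univ_val_map, Multiset.countP_map]
  rfl

/-- By Hall's theorem, the tuples can be completed to cover exactly the pairs in `SA ×ˢ SB`. -/
theorem exists_completion {L : List (Option N × Option N)}
    (hA : IsSide SA (L.map Prod.fst)) (hB : IsSide SB (L.map Prod.snd))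
    (h : HallCondition Covers (SA ×ˢ SB) L) :
    ∃ g : Fin L.length → Option N × Option N,
      (∀ i, g i ∈ SA ×ˢ SB ∧ Covers L[i] (g i)) ∧ ∀ l ∈ SA ×ˢ SB, ∃ i, g i = l := by
  classical
  -- Each pair of the rectangle gets its own index of a compatible tuple.
  have hall := (Finset.all_card_le_biUnion_card_iff_exists_injective
    (fun l : {l // l ∈ SA ×ˢ SB} =>
      Finset.univ.filter fun i : Fin L.length => Covers L[i] l.1)).1 fun W => by
    have h1 := h (W.map (Embedding.subtype _)) (by
      intro x hx
      obtain ⟨y, -, rfl⟩ := Finset.mem_map.1 hx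
      exact y.2)
    rw [Finset.card_map, countP_eq_card] at h1
    refine h1.trans (Finset.card_le_card fun i hi => ?_)
    simp only [Finset.mem_filter, Finset.mem_univ, true_and, Finset.mem_map, Finset.mem_biUnion]
      at hi ⊢
    obtain ⟨_, ⟨w, hw, rfl⟩, hc⟩ := hi
    exact ⟨w, hw, hc⟩
  obtain ⟨f, hf, hfc⟩ := hall
  -- Tuples not used by the matching also have to be completed inside the rectangle, lest they
  -- create new pairs.
  have hdef : ∀ t ∈ L, ∃ l ∈ SA ×ˢ SB, Covers t l := by
    rintro ⟨a, b⟩ ht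
    have hx : ∃ x ∈ SA, a = none ∨ a = x := by
      by_cases ha : a = none
      · obtain ⟨x, hx⟩ := hA.nonempty
        exact ⟨x, hx, .inl ha⟩
      · exact ⟨a, hA.mem_of_ne_none (List.mem_map_of_mem (f := Prod.fst) ht) ha, .inr rfl⟩
    have hy : ∃ y ∈ SB, b = none ∨ b = y := by
      by_cases hb : b = none
      · obtain ⟨x, hx⟩ := hB.nonempty
        exact ⟨x, hx, .inl hb⟩
      · exact ⟨b, hB.mem_of_ne_none (List.mem_map_of_mem (f := Prod.snd) ht) hb, .inr rfl⟩
    obtain ⟨x, hx, hx'⟩ := hx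
    obtain ⟨y, hy, hy'⟩ := hy
    exact ⟨(x, y), Finset.mem_product.2 ⟨hx, hy⟩, hx', hy'⟩
  have key : ∀ i : Fin L.length, ∃ l, (l ∈ SA ×ˢ SB ∧ Covers L[i] l) ∧ ∀ l', f l' = i → l = l'.1 := by
    intro i
    by_cases hi : ∃ l', f l' = i
    · obtain ⟨l', rfl⟩ := hi
      exact ⟨l'.1, ⟨l'.2, by simpa using hfc l'⟩, fun l'' h => congrArg _ (hf h.symm)⟩
    · obtain ⟨l, hl, hc⟩ := hdef L[i] (List.getElem_mem _)
      exact ⟨l, ⟨hl, hc⟩, fun l' h => absurd ⟨l', h⟩ hi⟩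
  choose g hg hg' using key
  exact ⟨g, hg, fun l hl => ⟨f ⟨l, hl⟩, hg' _ ⟨l, hl⟩ rfl⟩⟩

/-- Every element of `S` is realized by a value in the domain. -/
theorem exists_value (hnm : Injective nm) (hr : r.tuples = ts) (a : Option N) :
    ∃ v ∈ R.dom A, ∀ t ∈ ts, ∀ x, t A = some x → cellOf nm A t = a → x = v := by
  by_cases h : ∃ t ∈ ts, ∃ x, t A = some x ∧ cellOf nm A t = a
  · obtain ⟨t, ht, x, hx, rfl⟩ := h
    refine ⟨x, r.isTuple t (by simpa [hr] using ht) A x hx, fun t' _ x' hx' h => ?_⟩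
    simp only [cellOf, hx, hx', Option.map_some, Option.some.injEq] at h
    exact hnm h
  · obtain ⟨v, hv⟩ := Finset.card_pos.1 (two_pos.trans_le (R.two_le_card_dom A A.2))
    exact ⟨v, hv, fun t ht x hx h' => absurd ⟨t, ht, x, hx, h'⟩ h⟩

/-- A grounding can be prescribed by a value for each tuple and each attribute. -/
theorem exists_grounding (hr : r.tuples = ts) (v : Fin ts.length → R.attrs → Val)
    (hv : ∀ i (C : R.attrs), v i C ∈ R.dom C) (h : ∀ i C x, ts[i] C = some x → x = v i C) :
    ∃ r' : Relation R, r.IsGrounding r' ∧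
      ∀ t, t ∈ r'.tuples ↔ ∃ i, t = fun C => some (v i C) := by
  have ht : ∀ i, R.IsTuple fun C => some (v i C) := fun i C x hx => by
    obtain rfl : v i C = x := by simpa using hx
    exact hv i C
  refine ⟨⟨(Finset.univ : Finset (Fin ts.length)).val.map fun i C => some (v i C), fun t htm => ?_⟩,
    ?_, fun t => ?_⟩
  · obtain ⟨i, -, rfl⟩ := Multiset.mem_map.1 htm
    exact ht i
  · unfold Relation.IsGrounding
    have e : r.tuples = (Finset.univ : Finset (Fin ts.length)).val.map fun i => ts[i] := by
      rw [hr, Fin.univ_val_map]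
      exact congrArg _ List.ofFn_getElem.symm
    rw [e, Multiset.rel_map]
    refine Multiset.rel_refl_of_refl_on fun i _ => ⟨ht i, by simp, fun C hC => ?_⟩
    obtain ⟨x, hx⟩ := Option.ne_none_iff_exists'.1 hC
    rw [hx, h i C x hx]
  · simp [eq_comm]

/-- A grounding with prescribed values in the columns `A` and `B`. -/
theorem exists_grounding_pair (hr : r.tuples = ts) (a b : Fin ts.length → Val)
    (hab : A = B → a = b) (ha : ∀ i, a i ∈ R.dom A) (hb : ∀ i, b i ∈ R.dom B)
    (ha' : ∀ i x, ts[i] A = some x → x = a i) (hb' : ∀ i x, ts[i] B = some x → x = b i) :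
    ∃ r' : Relation R, r.IsGrounding r' ∧ (∀ t ∈ r'.tuples, ∀ C, t C ≠ none) ∧
      (∀ t ∈ r'.tuples, ∃ i, t A = some (a i) ∧ t B = some (b i)) ∧
      ∀ i, ∃ t ∈ r'.tuples, t A = some (a i) ∧ t B = some (b i) := by
  classical
  have key : ∀ (i : Fin ts.length) (C : R.attrs), ∃ v ∈ R.dom C, (∀ x, ts[i] C = some x → x = v) ∧
      (C = A → v = a i) ∧ (C = B → v = b i) := by
    intro i C
    by_cases hCA : C = A
    · subst hCA
      exact ⟨a i, ha i, ha' i, fun _ => rfl, fun h => congrFun (hab h) i⟩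
    · by_cases hCB : C = B
      · subst hCB
        exact ⟨b i, hb i, hb' i, fun h => absurd h hCA, fun _ => rfl⟩
      · obtain ⟨v, hv⟩ := Finset.card_pos.1 (two_pos.trans_le (R.two_le_card_dom C C.2))
        refine ⟨(ts[i] C).getD v, ?_, fun x hx => by simp [hx], fun h => absurd h hCA,
          fun h => absurd h hCB⟩
        cases hx : ts[i] C with
        | none => exact hv
        | some x =>
          exact r.isTuple ts[i] (by simp [hr]) C x hx
  choose v hv h1 h2 h3 using key
  obtain ⟨r', hg, hm⟩ := exists_grounding hr v hv h1
  refine ⟨r', hg, fun t ht C => ?_, fun t ht => ?_, fun i => ?_⟩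
  · obtain ⟨i, rfl⟩ := (hm t).1 ht
    simp
  · obtain ⟨i, rfl⟩ := (hm t).1 ht
    exact ⟨i, by simp [h2], by simp [h3]⟩
  · exact ⟨_, (hm _).2 ⟨i, rfl⟩, by simp [h2], by simp [h3]⟩

/-- The completed pairs form exactly the rectangle `SA ×ˢ SB`, and replacing names by domain values
preserves independence. Distinctness of `A` and `B` lets both columns be prescribed separately. -/
theorem satisfies_of_hallCondition (hnm : Injective nm) (hr : r.tuples = ts) (hAB : A ≠ B)
    (hA : IsSide SA (ts.map (cellOf nm A))) (hB : IsSide SB (ts.map (cellOf nm B)))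
    (h : HallCondition Covers (SA ×ˢ SB) (ts.map fun t => (cellOf nm A t, cellOf nm B t))) :
    r.Satisfies ⟨{(A : Att)}, {(B : Att)}⟩ := by
  obtain ⟨g', hg', hgs'⟩ := exists_completion (by simpa [Function.comp_def] using hA)
    (by simpa [Function.comp_def] using hB) h
  obtain ⟨g, hg, hgs⟩ : ∃ g : Fin ts.length → Option N × Option N,
      (∀ i, g i ∈ SA ×ˢ SB ∧ Covers (cellOf nm A ts[i], cellOf nm B ts[i]) (g i)) ∧
        ∀ l ∈ SA ×ˢ SB, ∃ i, g i = l := by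
    have e : (ts.map fun t => (cellOf nm A t, cellOf nm B t)).length = ts.length := by simp
    refine ⟨fun i => g' (i.cast e.symm), fun i => ?_, fun l hl => ?_⟩
    · simpa using hg' (i.cast e.symm)
    · obtain ⟨i, hi⟩ := hgs' l hl
      exact ⟨i.cast e, hi⟩
  choose va hva hva' using fun a => exists_value (A := A) hnm hr a
  choose vb hvb hvb' using fun b => exists_value (A := B) hnm hr b
  obtain ⟨r', hgr, hn, hmem, hex⟩ := exists_grounding_pair (A := A) (B := B) hr
    (fun i => va (g i).1) (fun i => vb (g i).2) (fun h => absurd h hAB) (fun i => hva _)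
    (fun i => hvb _)
    (fun i x hx => hva' _ _ (List.getElem_mem _) x hx
      ((hg i).2.1.resolve_left (by simp [cellOf, hx])))
    (fun i x hx => hvb' _ _ (List.getElem_mem _) x hx
      ((hg i).2.2.resolve_left (by simp [cellOf, hx])))
  refine ⟨r', hgr, fun t ht C _ => hn t ht C, fun t₁ ht₁ t₂ ht₂ => ?_⟩
  obtain ⟨i, hi, -⟩ := hmem t₁ ht₁
  obtain ⟨j, -, hj⟩ := hmem t₂ ht₂
  obtain ⟨k, hk⟩ := hgs ((g i).1, (g j).2) (Finset.mem_product.2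
    ⟨(Finset.mem_product.1 (hg i).1).1, (Finset.mem_product.1 (hg j).1).2⟩)
  obtain ⟨t, ht, h1, h2⟩ := hex k
  refine ⟨t, ht, fun C hC => ?_, fun C hC => ?_⟩
  · obtain rfl : C = A := Subtype.ext (by simpa using hC)
    rw [h1, hi, hk]
  · obtain rfl : C = B := Subtype.ext (by simpa using hC)
    rw [h2, hj, hk]

/-- Independence of `A` from itself means that the column is constant, so all non-null values must
agree; conversely a single common value can fill all nulls. -/
theorem satisfies_self_iff (hnm : Injective nm) (hr : r.tuples = ts)
    (hA : IsSide SA (ts.map (cellOf nm A))) :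
    r.Satisfies ⟨{(A : Att)}, {(A : Att)}⟩ ↔ SA.card ≤ 1 := by
  constructor
  · rintro ⟨r', hg, -, hind⟩
    rw [Finset.card_le_one]
    have key : ∀ x ∈ SA, ∀ t ∈ ts, cellOf nm A t ≠ none → x = cellOf nm A t := by
      intro x hx t ht hn
      rcases (hA x).1 hx with ⟨hxn, hxl⟩ | ⟨-, hall⟩
      · obtain ⟨t₁, ht₁, rfl⟩ := List.mem_map.1 hxl
        obtain ⟨t', ht', hgt⟩ := exists_rel_left hg (a := t) (by simpa [hr] using ht)
        obtain ⟨t₁', ht₁', hgt₁⟩ := exists_rel_left hg (a := t₁) (by simpa [hr] using ht₁)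
        obtain ⟨t₂, -, h1, h2⟩ := hind t' ht' t₁' ht₁'
        have h3 := hgt.2.2 A (by simpa [cellOf] using hn)
        have h4 := hgt₁.2.2 A (by simpa [cellOf] using hxn)
        rw [cellOf, cellOf, ← h3, ← h4, ← h1 A (by simp), h2 A (by simp)]
      · exact absurd (hall _ (List.mem_map_of_mem ht)) hn
    intro x hx y hy
    rcases (hA y).1 hy with ⟨hyn, hyl⟩ | ⟨rfl, hall⟩
    · obtain ⟨t, ht, rfl⟩ := List.mem_map.1 hyl
      exact key x hx t ht hyn
    · rcases (hA x).1 hx with ⟨hxn, hxl⟩ | ⟨rfl, -⟩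
      · exact hall x hxl
      · rfl
  · intro hcard
    obtain ⟨a, ha⟩ := hA.nonempty
    obtain ⟨v, hv, hv'⟩ := exists_value (A := A) hnm hr a
    have hva : ∀ (i : Fin ts.length) x, ts[i] A = some x → x = v := fun i x hx =>
      hv' _ (List.getElem_mem _) x hx (Finset.card_le_one.1 hcard _ (hA.mem_of_ne_none
        (List.mem_map_of_mem (List.getElem_mem _))
        (show (ts[i] A).map nm ≠ none by simp [hx])) _ ha)
    obtain ⟨r', hgr, hn, hmem, -⟩ := exists_grounding_pair (A := A) (B := A) hr (fun _ => v)
      (fun _ => v) (fun _ => rfl) (fun _ => hv) (fun _ => hv) hva hva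
    refine ⟨r', hgr, fun t ht C _ => hn t ht C, fun t₁ ht₁ t₂ ht₂ => ⟨t₁, ht₁, fun _ _ => rfl,
      fun C hC => ?_⟩⟩
    obtain rfl : C = A := Subtype.ext (by simpa using hC)
    obtain ⟨-, h1, -⟩ := hmem t₁ ht₁
    obtain ⟨-, h2, -⟩ := hmem t₂ ht₂
    rw [h1, h2]

/-- The empty relation is treated separately: both sides would consist of the placeholder, and
Hall's condition fails for that pair, as there is no tuple. -/
theorem satisfies_nil (hr : r.tuples = 0) (σ : PIA Att) : r.Satisfies σ :=
  ⟨⟨0, by simp⟩, by simp [Relation.IsGrounding, hr], by simp [Relation.Indep]⟩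

end Hall

end Semantics

/-! ### The decision procedure -/

section

variable {N : Type}

section

variable [DecidableEq N]

/-- The distinct elements of a list. -/
def distinct (l : List N) : List N := l.foldl (fun b a => if a ∈ b then b else a :: b) []

theorem nodup_distinct (l : List N) : (distinct l).Nodup := by
  suffices ∀ b : List N, b.Nodup → (l.foldl (fun b a => if a ∈ b then b else a :: b) b).Nodup from
    this [] List.nodup_nil
  induction l with
  | nil => simp
  | cons a l ih =>
    intro b hb
    refine ih _ ?_
    dsimp only
    split_ifs with h
    · exact hb
    · exact List.nodup_cons.2 ⟨h, hb⟩

theorem mem_distinct {l : List N} {x : N} : x ∈ distinct l ↔ x ∈ l := by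
  suffices ∀ b : List N,
      x ∈ l.foldl (fun b a => if a ∈ b then b else a :: b) b ↔ x ∈ b ∨ x ∈ l by
    simpa [distinct] using this []
  induction l with
  | nil => simp
  | cons a l ih =>
    intro b
    rw [List.foldl_cons, ih]
    split_ifs with h
    · simp only [List.mem_cons]
      constructor
      · tauto
      · rintro (h' | rfl | h') <;> tauto
    · simp only [List.mem_cons]
      tauto

/-- The distinct non-null cells of a list, or the null cell if there are none. -/
def sideValues (l : List (Option N)) : List (Option N) :=
  if distinct (l.filter fun x => x ≠ none) = [] then [none]
  else distinct (l.filter fun x => x ≠ none)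

theorem nodup_sideValues (l : List (Option N)) : (sideValues l).Nodup := by
  unfold sideValues
  split_ifs
  · simp
  · exact nodup_distinct _

theorem isSide_sideValues (l : List (Option N)) : IsSide (sideValues l).toFinset l := by
  intro x
  unfold sideValues
  have hm : ∀ y, y ∈ distinct (l.filter fun x => x ≠ none) ↔ y ∈ l ∧ y ≠ none := fun y => by
    simp [mem_distinct]
  split_ifs with h
  · simp only [h, List.not_mem_nil, false_iff, not_and, not_not] at hm
    simp only [List.toFinset_cons, List.toFinset_nil, insert_empty_eq, Finset.mem_singleton]
    exact ⟨fun h => .inr ⟨h, hm⟩, fun h => h.elim (fun h => absurd (hm x h.2) h.1) And.left⟩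
  · rw [List.mem_toFinset, hm]
    obtain ⟨y, hy⟩ := List.exists_mem_of_ne_nil _ h
    rw [hm] at hy
    exact ⟨fun h => .inl h.symm, fun h => h.elim And.symm fun h => absurd (h.2 y hy.1) hy.2⟩

/-- The cell of the row `w` in the column `A`. -/
def cellAt (cols : List N) (A : N) (w : List (Option N)) : Option N :=
  (cols.foldl (fun (s : List (Option N) × Bool) c =>
    if s.2 = true ∨ c = A then (s.1, true) else (s.1.tail, false)) (w, false)).1.headD none

/-- The flag records that the first occurrence of `A` has been reached; before that, every column
drops one cell. -/
theorem cellAt_eq (cols : List N) (A : N) (w : List (Option N)) :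
    cellAt cols A w = w.getD (cols.idxOf A) none := by
  have h : ∀ (cols : List N) (w : List (Option N)),
      (cols.foldl (fun (s : List (Option N) × Bool) c =>
        if s.2 = true ∨ c = A then (s.1, true) else (s.1.tail, false)) (w, true)).1 = w := by
    intro cols
    induction cols with
    | nil => simp
    | cons c cols ih => intro w; simpa using ih w
  unfold cellAt
  induction cols generalizing w with
  | nil => cases w <;> simp
  | cons c cols ih =>
    rw [List.foldl_cons]
    by_cases hc : c = A
    · simp only [hc, or_true, if_true, h, List.idxOf_cons_self]
      cases w <;> rfl
    · simp only [hc, Bool.false_eq_true, or_self, if_false, ih, List.idxOf_cons_ne _ hc]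
      cases w <;> simp

theorem idxOf_map {M : Type} [DecidableEq M] {f : M → N} (hf : Injective f) (l : List M) (a : M) :
    (l.map f).idxOf (f a) = l.idxOf a := by
  induction l with
  | nil => rfl
  | cons c l ih =>
    by_cases hc : c = a
    · simp [hc]
    · rw [List.map_cons, List.idxOf_cons_ne _ hc, List.idxOf_cons_ne _ (hf.ne hc), ih]

/-- A row of cells and the string of its multiplicity. -/
abbrev RowCode (N : Type) := List (Option N) × List Bool

/-- The cells in the column `A`. -/
def column (cols : List N) (A : N) (rows : List (RowCode N)) : List (Option N) :=
  rows.map fun w => cellAt cols A w.1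

/-- Decide the possible independence of two columns, where `cap n m` is the minimum of `n` and the
multiplicity represented by `m`. -/
def solve (cap : ℕ → List Bool → ℕ) (A B : N) (cols : List N) (rows : List (RowCode N)) : Bool :=
  let L := sideValues (column cols A rows) ×ˢ sideValues (column cols B rows)
  if A = B then decide ((sideValues (column cols A rows)).length ≤ 1)
  else decide (rows = [] ∨ (auction Covers L (rows.flatMap fun w =>
    List.replicate (cap L.length w.2) (cellAt cols A w.1, cellAt cols B w.1))).1 = [])

end

/-! ### Truncated multiplicities -/

/-- Strings of multiplicities. -/
def MultiplicityCoding.bits : MultiplicityCoding → ℕ → List Bool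
  | .unary, m => unaryEncodeNat m
  | .binary, m => encodeNat m

/-- The minimum of `n` and the multiplicity represented by a string. -/
def MultiplicityCoding.cap : MultiplicityCoding → ℕ → List Bool → ℕ
  | .unary, n, l => min n l.length
  | .binary, n, l => l.foldr (fun b k => min n (k + k + if b = true then 1 else 0)) 0

/-- In binary the least significant bit comes first, so the right fold doubles from the most
significant bit on. Truncating at `n` after every doubling does not change the value truncated at
the end. -/
theorem cap_bits (μ : MultiplicityCoding) (n m : ℕ) : μ.cap n (μ.bits m) = min n m := by
  cases μ with
  | unary => exact congrArg (min n) (unary_decode_encode_nat m)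
  | binary =>
    have h : ∀ p : PosNum, MultiplicityCoding.cap .binary n (encodePosNum p) = min n (p : ℕ) := by
      intro p
      simp only [MultiplicityCoding.cap]
      induction p with
      | one => simp [encodePosNum]
      | bit0 p ih => simp [encodePosNum, ih, PosNum.cast_bit0]; omega
      | bit1 p ih => simp [encodePosNum, ih, PosNum.cast_bit1]; omega
    change MultiplicityCoding.cap .binary n (encodeNum m) = min n m
    conv_rhs => rw [← Num.to_of_nat m]
    cases (m : Num) with
    | zero => simp [encodeNum, MultiplicityCoding.cap]
    | pos p => exact h p

/-! ### Polynomial time of the decision procedure -/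

namespace PolyFun

variable {γ : Type} [Enc γ]

/-- Doubling is not additive growth, so `foldl_of_le` does not apply; but truncation keeps every
intermediate value at most `n c`, whose unary size is polynomial. -/
theorem capped (μ : MultiplicityCoding) {n : γ → ℕ} {l : γ → List Bool} (hn : PolyFun n)
    (hl : PolyFun l) : PolyFun fun c => μ.cap (n c) (l c) := by
  cases μ with
  | unary => exact hn.min hl.length
  | binary =>
    obtain ⟨Q, hQ⟩ := hn.size_le
    have hk : PolyFun fun x : γ × ℕ × Bool => x.2.1 := fst.comp snd
    refine (foldl (step := fun c k (b : Bool) => Min.min (n c) (k + k + if b = true then 1 else 0))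
      (const 0) hl.listReverse ((hn.comp fst).min ((hk.add hk).add
        (ite (eq (snd.comp snd) (const true)) (const 1) (const 0)))) Q ?_).congr fun c => ?_
    · intro c l' _
      refine le_trans ?_ (hQ c)
      rw [size_nat, size_nat]
      induction l' using List.reverseRecOn with
      | nil => simp
      | append_singleton l' b _ => simp only [List.foldl_append, List.foldl_cons, List.foldl_nil]; omega
    · rw [List.foldl_reverse]
      rfl

variable [Enc N] [LawfulEnc N] [DecidableEq N]

theorem distinct {l : γ → List N} (hl : PolyFun l) : PolyFun fun c => distinct (l c) :=
  foldl_of_le (const []) hl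
    (ite (mem (snd.comp snd) (fst.comp snd)) (fst.comp snd)
      (cons (snd.comp snd) (fst.comp snd))) .X fun c b a => by
      split_ifs <;> simp; omega

theorem sideValues {l : γ → List (Option N)} (hl : PolyFun l) :
    PolyFun fun c => sideValues (l c) := by
  have h := distinct (hl.filter (P := fun _ x => x ≠ none) (not (eq snd (const none))))
  exact ite h.eq_nil (const [none]) h

theorem cellAt {cols : γ → List N} {A : γ → N} {w : γ → List (Option N)} (hc : PolyFun cols)
    (hA : PolyFun A) (hw : PolyFun w) : PolyFun fun c => cellAt (cols c) (A c) (w c) := by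
  have hs : PolyFun fun x : γ × (List (Option N) × Bool) × N => x.2.1 := fst.comp snd
  refine headD (fst.comp (foldl_of_le (step := fun c (s : List (Option N) × Bool) a =>
    if s.2 = true ∨ a = A c then (s.1, true) else (s.1.tail, false)) (hw.pair (const false)) hc
    (ite (or (eq (snd.comp hs) (const true)) (eq (snd.comp snd) (hA.comp fst)))
      ((fst.comp hs).pair (const true)) ((tail (fst.comp hs)).pair (const false))) 4 ?_))
    (const none)
  rintro c ⟨l, b⟩ a
  have h3 : ∀ b : Bool, 1 ≤ size b ∧ size b ≤ 3 := by decide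
  have h1 := h3 b
  have h2 := h3 true
  have h4 := h3 false
  split_ifs
  · simp; omega
  · cases l <;> simp <;> omega

theorem covers : PolyFun fun x : (Option N × Option N) × Option N × Option N =>
    decide (Covers x.1 x.2) :=
  and (or (eq (fst.comp fst) (const none)) (eq (fst.comp fst) (fst.comp snd)))
    (or (eq (snd.comp fst) (const none)) (eq (snd.comp fst) (snd.comp snd)))

theorem solve (μ : MultiplicityCoding) {A B : γ → N} {cols : γ → List N}
    {rows : γ → List (RowCode N)} (hA : PolyFun A) (hB : PolyFun B) (hc : PolyFun cols)
    (hr : PolyFun rows) : PolyFun fun c => solve μ.cap (A c) (B c) (cols c) (rows c) := by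
  have hcol {A : γ → N} (hA : PolyFun A) :
      PolyFun fun c => PossibleIndependence.sideValues (column (cols c) (A c) (rows c)) :=
    sideValues (map (g := fun c (w : RowCode N) => PossibleIndependence.cellAt (cols c) (A c) w.1)
      hr (cellAt (hc.comp fst) (hA.comp fst) (fst.comp snd)))
  have hL := product (hcol hA) (hcol hB)
  have ht : PolyFun fun c => (rows c).flatMap fun w => List.replicate
      (μ.cap (PossibleIndependence.sideValues (column (cols c) (A c) (rows c)) ×ˢ
        PossibleIndependence.sideValues (column (cols c) (B c) (rows c))).length w.2)
      (PossibleIndependence.cellAt (cols c) (A c) w.1,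
        PossibleIndependence.cellAt (cols c) (B c) w.1) :=
    flatMap (g := fun c (w : RowCode N) => List.replicate
      (μ.cap (PossibleIndependence.sideValues (column (cols c) (A c) (rows c)) ×ˢ
        PossibleIndependence.sideValues (column (cols c) (B c) (rows c))).length w.2)
      (PossibleIndependence.cellAt (cols c) (A c) w.1,
        PossibleIndependence.cellAt (cols c) (B c) w.1)) hr
      (replicate (capped μ (hL.length.comp fst) (snd.comp snd))
        ((cellAt (hc.comp fst) (hA.comp fst) (fst.comp snd)).pair
          (cellAt (hc.comp fst) (hB.comp fst) (fst.comp snd))))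
  exact ite (eq hA hB) (le (length (hcol hA)) (const 1))
    (or (eq_nil hr) (eq_nil (fst.comp ((auction covers).comp (hL.pair ht)))))

end PolyFun

/-! ### Correctness of the decision procedure -/

/-- Truncating the summands at `n` does not affect the sum truncated at `n`, and a comparison with
`k ≤ n` sees no more than that. -/
theorem le_countP_flatMap_replicate_min {ι T : Type} (p : T → Prop) [DecidablePred p]
    (f : ι → T) (m : ι → ℕ) (rows : List ι) {n k : ℕ} (hk : k ≤ n) :
    k ≤ (rows.flatMap fun w => List.replicate (min n (m w)) (f w)).countP p ↔
      k ≤ (rows.flatMap fun w => List.replicate (m w) (f w)).countP p := by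
  suffices h : min n ((rows.flatMap fun w => List.replicate (min n (m w)) (f w)).countP p) =
      min n ((rows.flatMap fun w => List.replicate (m w) (f w)).countP p) by
    constructor <;> intro h' <;> omega
  induction rows with
  | nil => simp
  | cons w rows ih =>
    simp only [List.flatMap_cons, List.countP_append, List.countP_replicate]
    split_ifs <;> omega

end

theorem encodeNat_injective : Injective encodeNat :=
  fun a b h => by rw [← decode_encodeNat a, h, decode_encodeNat]

/-- The columns of a table, with attributes represented by strings. -/
def Table.colCode (T : Table) : List (List Bool) := T.cols.map fun c => encodeNat c.1

/-- The rows of a table, with values and multiplicities represented by strings. -/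
def Table.rowCode (μ : MultiplicityCoding) (T : Table) : List (RowCode (List Bool)) :=
  T.rows.map fun w => (w.1.map (Option.map encodeNat), μ.bits w.2)

theorem cellAt_colCode (T : Table) (A : T.schema.attrs) (w : List (Option ℕ)) :
    cellAt T.colCode (encodeNat A) (w.map (Option.map encodeNat)) =
      cellOf encodeNat A (T.entry w) := by
  have h : T.colCode = (T.cols.map Prod.fst).map encodeNat := by simp [Table.colCode]
  rw [cellAt_eq, h, idxOf_map encodeNat_injective, cellOf, Table.entry]
  simp only [List.getD_eq_getElem?_getD, List.getElem?_map]
  cases w[(T.cols.map Prod.fst).idxOf (A : ℕ)]? <;> rfl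

theorem solve_iff (μ : MultiplicityCoding) (T : Table) (A B : T.schema.attrs) :
    solve μ.cap (encodeNat A) (encodeNat B) T.colCode (T.rowCode μ) = true ↔
      T.relation.Satisfies ⟨{(A : ℕ)}, {(B : ℕ)}⟩ := by
  set ts : List T.schema.Row := T.rows.flatMap fun w => List.replicate w.2 (T.entry w.1) with hts
  have hr : T.relation.tuples = ts := rfl
  -- Multiplicities are positive, so the listed rows and the tuples of the relation show the same
  -- cells.
  have hside (A : T.schema.attrs) : IsSide
      (sideValues (column T.colCode (encodeNat A) (T.rowCode μ))).toFinset
      (ts.map (cellOf encodeNat A)) := by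
    have h : ∀ x, x ∈ column T.colCode (encodeNat A) (T.rowCode μ) ↔
        x ∈ ts.map (cellOf encodeNat A) := by
      intro x
      simp only [column, Table.rowCode, List.map_map, List.mem_map, Function.comp_apply,
        cellAt_colCode, hts, List.mem_flatMap, List.mem_replicate]
      constructor
      · rintro ⟨w, hw, rfl⟩
        exact ⟨_, ⟨w, hw, (T.mult_pos w hw).ne', rfl⟩, rfl⟩
      · rintro ⟨_, ⟨w, hw, -, rfl⟩, rfl⟩
        exact ⟨w, hw, rfl⟩
    have := isSide_sideValues (column T.colCode (encodeNat A) (T.rowCode μ))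
    unfold IsSide at this ⊢
    simpa only [h] using this
  unfold solve
  by_cases hAB : A = B
  · subst hAB
    simp only [if_true, decide_eq_true_eq]
    rw [satisfies_self_iff encodeNat_injective hr (hside A),
      List.toFinset_card_of_nodup (nodup_sideValues _)]
  · have hne : encodeNat (A : ℕ) ≠ encodeNat (B : ℕ) := fun h =>
      hAB (Subtype.ext (encodeNat_injective h))
    simp only [if_neg hne, decide_eq_true_eq]
    by_cases hrows : T.rows = []
    · refine iff_of_true (.inl (by simp [Table.rowCode, hrows])) (satisfies_nil ?_ _)
      simp [hr, hts, hrows]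
    · have hts0 : ts ≠ [] := by
        obtain ⟨w, hw⟩ := List.exists_mem_of_ne_nil _ hrows
        refine List.ne_nil_of_mem (a := T.entry w.1) (List.mem_flatMap.2 ⟨w, hw, ?_⟩)
        exact List.mem_replicate.2 ⟨(T.mult_pos w hw).ne', rfl⟩
      rw [or_iff_right (by simpa [Table.rowCode] using hrows), auction_eq_nil_iff
        ((nodup_sideValues _).product (nodup_sideValues _))]
      set SA := sideValues (column T.colCode (encodeNat A) (T.rowCode μ))
      set SB := sideValues (column T.colCode (encodeNat B) (T.rowCode μ))
      have e : (SA ×ˢ SB).toFinset = SA.toFinset ×ˢ SB.toFinset := by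
        ext x
        simp [List.mem_product (α := Option (List Bool)) (β := Option (List Bool))]
      have key : HallCondition Covers (SA ×ˢ SB).toFinset ((T.rowCode μ).flatMap fun w =>
          List.replicate (μ.cap (SA ×ˢ SB).length w.2)
            (cellAt T.colCode (encodeNat A) w.1, cellAt T.colCode (encodeNat B) w.1)) ↔
          HallCondition Covers (SA.toFinset ×ˢ SB.toFinset)
            (ts.map fun t => (cellOf encodeNat A t, cellOf encodeNat B t)) := by
        simp only [Table.rowCode, List.flatMap_map, cap_bits, cellAt_colCode, hts,
          List.map_flatMap, List.map_replicate, ← e]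
        -- Only sets `W` inside the rectangle matter, and they have at most as many elements as the
        -- truncation bound.
        refine forall₂_congr fun W hW => le_countP_flatMap_replicate_min _ _ _ _ ?_
        exact (Finset.card_le_card hW).trans (List.toFinset_card_le _)
      rw [key]
      exact ⟨satisfies_of_hallCondition encodeNat_injective hr hAB (hside A) (hside B),
        hallCondition_of_satisfies hr hts0 (hside A) (hside B)⟩

/-! ### Reading the input -/

namespace Data

/-- The left subtree. -/
def left : Data → Data
  | nil => nil
  | node a _ => a

/-- The right subtree. -/
def right : Data → Data
  | nil => nil
  | node _ b => b

/-- The tree as the tree of a list. -/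
def toList : Data → List Data
  | nil => []
  | node a b => a :: b.toList

theorem enc_toList (d : Data) : enc d.toList = d := by
  induction d with
  | nil => rfl
  | node a b _ ih => exact congrArg (node a) ih

theorem toList_enc {α : Type} [Enc α] (l : List α) : (enc l).toList = l.map enc := by
  induction l with
  | nil => rfl
  | cons a l ih => exact congrArg (List.cons (enc a)) ih

/-- The tree as the tree of a string of bits. -/
def toBits (d : Data) : List Bool := d.toList.map fun x => decide (x ≠ nil)

theorem toBits_enc (l : List Bool) : (enc l).toBits = l := by
  rw [toBits, toList_enc, List.map_map]
  refine (List.map_congr_left fun b _ => ?_).trans (List.map_id l)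
  cases b <;> rfl

/-- The item for a name. -/
def ofName (l : List Bool) : Data := node nil (enc l)

/-- The item for a list of items. -/
def ofItems (l : List Data) : Data := node (node nil nil) (enc l)

/-- The name represented by an item. -/
def toName (d : Data) : List Bool := d.right.toBits

/-- The list of items represented by an item. -/
def toItems (d : Data) : List Data := d.right.toList

/-- The cell represented by an item. -/
def toCell (d : Data) : Option (List Bool) := if d = nil then none else some d.toName

@[simp] theorem toName_ofName (l : List Bool) : (ofName l).toName = l := toBits_enc l

@[simp] theorem toItems_ofItems (l : List Data) : (ofItems l).toItems = l :=
  (toList_enc l).trans (List.map_id l)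

end Data

open Data (ofName ofItems)

/-- One step of the parser. The state consists of the bits read since the last comma, the items of
the innermost open list and those of the outer ones, in reverse order. -/
def parseStep (s : List Bool × List Data × List (List Data)) (g : Γ') :
    List Bool × List Data × List (List Data) :=
  if g = .blank then (s.1, .nil :: s.2.1, s.2.2)
  else if g = .comma then ([], ofName s.1.reverse :: s.2.1, s.2.2)
  else if g = .bra then (s.1, [], s.2.1 :: s.2.2)
  else if g = .ket then (s.1, ofItems s.2.1.reverse :: s.2.2.headD [], s.2.2.tail)
  else (decide (g = .bit true) :: s.1, s.2.1, s.2.2)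

/-- The items in a string. -/
def parse (w : List Γ') : List Data := (w.foldl parseStep ([], [], [])).2.1.reverse

/-- The string `w` represents the list `l` of items. -/
def Parses (w : List Γ') (l : List Data) : Prop :=
  ∀ top rest, w.foldl parseStep ([], top, rest) = ([], l.reverse ++ top, rest)

namespace Parses

theorem parse_eq {w : List Γ'} {l : List Data} (h : Parses w l) : parse w = l := by
  simp [parse, h [] []]

theorem append {w w' : List Γ'} {l l' : List Data} (h : Parses w l) (h' : Parses w' l') :
    Parses (w ++ w') (l ++ l') := fun top rest => by
  rw [List.foldl_append, h, h', List.reverse_append, List.append_assoc]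

theorem flatMap {α : Type} {e : α → List Γ'} {f : α → List Data} (h : ∀ a, Parses (e a) (f a))
    (l : List α) : Parses (l.flatMap e) (l.flatMap f) := by
  induction l with
  | nil => exact fun _ _ => rfl
  | cons a l ih => exact (h a).append ih

/-- The opening bracket stores the current items on the stack, and the closing one restores them
with the new item in front. As `Parses` allows any items and open lists around the string, the
contents can be parsed independently of the nesting. -/
theorem list {α : Type} {e : α → List Γ'} {f : α → List Data} (h : ∀ a, Parses (e a) (f a))
    (l : List α) : Parses (encodeListWith e l) [ofItems (l.flatMap f)] := fun top rest => by
  rw [encodeListWith, List.foldl_cons, List.foldl_append]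
  change List.foldl parseStep (List.foldl parseStep ([], [], top :: rest) _) _ = _
  rw [flatMap h]
  simp [parseStep]

theorem bits (l : List Bool) : Parses (l.map Γ'.bit ++ [Γ'.comma]) [ofName l] := fun top rest => by
  have h : ∀ b : List Bool, (l.map Γ'.bit).foldl parseStep (b, top, rest) =
      (l.reverse ++ b, top, rest) := by
    induction l with
    | nil => simp
    | cons a l ih => intro b; simp [ih, parseStep]
  rw [List.foldl_append, h]
  simp [parseStep]

theorem name (n : ℕ) : Parses (encodeName n) [ofName (encodeNat n)] := bits _

theorem cell (c : Option ℕ) :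
    Parses (encodeCell c) [c.elim .nil fun v => ofName (encodeNat v)] := by
  cases c with
  | none => exact fun _ _ => by simp [encodeCell, parseStep]
  | some v => exact name v

theorem mult (μ : MultiplicityCoding) (m : ℕ) : Parses (μ.encode m) [ofName (μ.bits m)] := by
  cases μ <;> exact bits _

theorem table (μ : MultiplicityCoding) (T : Table) : Parses (T.encode μ)
    [ofItems (T.cols.flatMap fun c => [ofName (encodeNat c.1),
      ofItems (c.2.flatMap fun v => [ofName (encodeNat v)])]),
    ofItems (T.rows.flatMap fun w => [ofItems (w.1.flatMap fun c =>
      [c.elim .nil fun v => ofName (encodeNat v)]), ofName (μ.bits w.2)])] :=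
  have h1 (c : ℕ × List ℕ) := (name c.1).append (list name c.2)
  have h2 (w : List (Option ℕ) × ℕ) := (list cell w.1).append (mult μ w.2)
  (list h1 T.cols).append (list h2 T.rows)

end Parses

/-- The names of the columns. -/
def readCols (d : Data) : List (List Bool) :=
  (d.toItems.filter fun x => x.left = .nil).map Data.toName

/-- Group lists of items with the names following them. -/
def pairStep (s : Data × List (Data × Data)) (x : Data) : Data × List (Data × Data) :=
  if x.left = .nil then (.nil, (s.1, x) :: s.2) else (x, s.2)

/-- The rows of the table. -/
def readRows (d : Data) : List (RowCode (List Bool)) :=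
  (d.toItems.foldl pairStep (.nil, [])).2.reverse.map fun x =>
    (x.1.toItems.map Data.toCell, x.2.toName)

/-- An item for a name has the left subtree `nil`, an item for a list has not, so the filter keeps
the attributes and drops the domains, which the decision procedure does not consult. -/
theorem readCols_table (T : Table) :
    readCols (ofItems (T.cols.flatMap fun c => [ofName (encodeNat c.1),
      ofItems (c.2.flatMap fun v => [ofName (encodeNat v)])])) = T.colCode := by
  rw [readCols, Data.toItems_ofItems, Table.colCode]
  induction T.cols with
  | nil => rfl
  | cons c l ih =>
    have h1 : (ofName (encodeNat c.1)).left = .nil := rfl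
    have h2 : ∀ l, (ofItems l).left ≠ .nil := fun l => by simp [ofItems, Data.left]
    simp [h1, h2, ih]

/-- Cell lists and multiplicities alternate. After each row the first component of the state is
again `nil`, so the induction only has to generalise the output. -/
theorem readRows_table (μ : MultiplicityCoding) (T : Table) :
    readRows (ofItems (T.rows.flatMap fun w => [ofItems (w.1.flatMap fun c =>
      [c.elim .nil fun v => ofName (encodeNat v)]), ofName (μ.bits w.2)])) = T.rowCode μ := by
  rw [readRows, Data.toItems_ofItems, Table.rowCode]
  have h : ∀ (l : List (List (Option ℕ) × ℕ)) (out : List (Data × Data)),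
      ((l.flatMap fun w => [ofItems (w.1.flatMap fun c =>
        [c.elim .nil fun v => ofName (encodeNat v)]), ofName (μ.bits w.2)]).foldl pairStep
          (.nil, out)).2 =
      (l.map fun w => (ofItems (w.1.flatMap fun c =>
        [c.elim .nil fun v => ofName (encodeNat v)]), ofName (μ.bits w.2))).reverse ++ out := by
    intro l
    induction l with
    | nil => simp
    | cons w l ih =>
      intro out
      have h1 : ∀ l, (ofName l).left = .nil := fun l => rfl
      have h2 : ∀ l, (ofItems l).left ≠ .nil := fun l => by simp [ofItems, Data.left]
      simp [pairStep, h1, h2, ih]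
  rw [h, List.append_nil, List.reverse_reverse, List.map_map]
  refine List.map_congr_left fun w _ => ?_
  simp only [Function.comp_apply, Data.toItems_ofItems, Data.toName_ofName, Prod.mk.injEq, and_true,
    List.map_flatMap]
  induction w.1 with
  | nil => rfl
  | cons c l ih =>
    rw [List.flatMap_cons, ih]
    cases c <;> simp [Data.toCell, ofName, Data.toName, Data.right, Data.toBits_enc]

/-! ### Polynomial time of the parser -/

namespace PolyFun

variable {γ : Type} [Enc γ]

theorem toList {f : γ → Data} (hf : PolyFun f) : PolyFun fun c => (f c).toList :=
  hf.congr_enc fun c => (f c).enc_toList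

theorem left {f : γ → Data} (hf : PolyFun f) : PolyFun fun c => (f c).left :=
  (headD hf.toList (const Data.nil)).congr fun c => by cases f c <;> rfl

theorem right {f : γ → Data} (hf : PolyFun f) : PolyFun fun c => (f c).right :=
  (tail hf.toList).congr_enc fun c => by
    rcases f c with _ | ⟨a, b⟩
    · rfl
    · exact b.enc_toList.symm

theorem toName {f : γ → Data} (hf : PolyFun f) : PolyFun fun c => (f c).toName :=
  map (g := fun _ (x : Data) => decide (x ≠ Data.nil)) hf.right.toList (not (eq snd (const Data.nil)))

theorem toItems {f : γ → Data} (hf : PolyFun f) : PolyFun fun c => (f c).toItems := hf.right.toList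

theorem toCell {f : γ → Data} (hf : PolyFun f) : PolyFun fun c => (f c).toCell :=
  ite (eq hf (const Data.nil)) (const none) hf.toName.some

theorem readCols {f : γ → Data} (hf : PolyFun f) : PolyFun fun c => readCols (f c) :=
  map (g := fun _ (x : Data) => x.toName)
    (filter (P := fun _ (x : Data) => x.left = Data.nil) hf.toItems (eq (left snd) (const Data.nil))) (toName snd)

theorem readRows {f : γ → Data} (hf : PolyFun f) : PolyFun fun c => readRows (f c) := by
  have hs : PolyFun fun x : γ × (Data × List (Data × Data)) × Data => x.2.1 := fst.comp snd
  have hx : PolyFun fun x : γ × (Data × List (Data × Data)) × Data => x.2.2 := snd.comp snd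
  refine map (g := fun _ (x : Data × Data) => (x.1.toItems.map Data.toCell, x.2.toName))
    (listReverse (snd.comp (foldl_of_le (step := fun _ => pairStep) (const (Data.nil, []))
      hf.toItems (ite (eq hx.left (const Data.nil))
        ((const Data.nil).pair (((fst.comp hs).pair hx).cons (snd.comp hs)))
        (hx.pair (snd.comp hs))) (.X + 4) ?_)))
    ((map (g := fun _ (d : Data) => d.toCell) (toItems (fst.comp snd)) (toCell snd)).pair
      (toName (snd.comp snd)))
  rintro c ⟨d, l⟩ x
  have h1 : size Data.nil = 1 := rfl
  unfold pairStep
  split_ifs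
  · simp [h1]; omega
  · have := size_pos d
    simp; omega

theorem ofName {f : γ → List Bool} (hf : PolyFun f) : PolyFun fun c => ofName (f c) :=
  ((const Data.nil).pair hf).congr_enc fun _ => rfl

theorem ofItems {f : γ → List Data} (hf : PolyFun f) : PolyFun fun c => ofItems (f c) :=
  ((const (Data.node .nil .nil)).pair hf).congr_enc fun _ => rfl

theorem size_reverse {α : Type} [Enc α] (l : List α) : size l.reverse = size l := by
  induction l with
  | nil => rfl
  | cons a l ih =>
    have := size_append l.reverse [a]
    simp at this ⊢
    omega

theorem parse : PolyFun parse := by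
  have hs : PolyFun fun x : List Γ' × (List Bool × List Data × List (List Data)) × Γ' => x.2.1 :=
    fst.comp snd
  have hg (g : Γ') : PolyFun fun x : List Γ' × (List Bool × List Data × List (List Data)) × Γ' =>
      decide (x.2.2 = g) := eq (snd.comp snd) (const g)
  have h1 := fst.comp hs
  have h2 := fst.comp (snd.comp hs)
  have h3 := snd.comp (snd.comp hs)
  -- Each symbol creates a bounded number of new tree nodes; brackets and commas merely regroup what
  -- has been read. Hence the additive constant.
  refine listReverse (fst.comp (snd.comp (foldl_of_le (step := fun _ => parseStep)
    (const ([], [], [])) id (ite (hg _) (h1.pair (((const Data.nil).cons h2).pair h3)) <|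
      ite (hg _) ((const []).pair ((h1.listReverse.ofName.cons h2).pair h3)) <|
      ite (hg _) (h1.pair ((const []).pair (h2.cons h3))) <|
      ite (hg _) (h1.pair ((h2.listReverse.ofItems.cons (headD h3 (const []))).pair h3.tail)) <|
      ((hg _).cons h1).pair (h2.pair h3)) 10 ?_)))
  rintro c ⟨b, top, rest⟩ g
  have e1 : size Data.nil = 1 := rfl
  have e2 : ∀ l : List Bool, size (Data.ofName l) = 2 + size l := fun l => by
    simp [size, Data.ofName, enc, Data.str]; omega
  have e3 : ∀ l : List Data, size (Data.ofItems l) = 4 + size l := fun l => by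
    simp [size, Data.ofItems, enc, Data.str]; omega
  have e4 : ∀ b : Bool, size b ≤ 3 := by decide
  unfold parseStep
  split_ifs
  · simp [e1]; omega
  · simp [e2, size_reverse]; omega
  · simp; omega
  · cases rest <;> simp [e3, size_reverse] <;> omega
  · have := e4 (decide (g = Γ'.bit true))
    simp; omega

end PolyFun

/-! ### The main theorem -/

theorem dataComplexityInPolyTime (μ : MultiplicityCoding) :
    DataComplexityInPolyTime μ unaryPIAs := by
  rintro ⟨X, Y⟩ ⟨hX, hY⟩
  obtain ⟨A, rfl⟩ := Finset.card_eq_one.1 hX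
  obtain ⟨B, rfl⟩ := Finset.card_eq_one.1 hY
  -- The atom is fixed, so the names of its attributes enter as constants.
  have hF : PolyFun fun w => solve μ.cap (encodeNat A) (encodeNat B)
      (readCols ((parse w).headD .nil)) (readRows ((parse w).tail.headD .nil)) :=
    .solve μ (.const _) (.const _) (.readCols (.headD .parse (.const _)))
      (.readRows (.headD (.tail .parse) (.const _)))
  refine hF.inPolyTime fun ⟨T, hT⟩ => ?_
  have hA : A ∈ T.schema.attrs := hT.1 (Finset.mem_singleton_self A)
  have hB : B ∈ T.schema.attrs := hT.2 (Finset.mem_singleton_self B)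
  rw [(Parses.table μ T).parse_eq]
  simp only [List.headD_cons, List.tail_cons, readCols_table, readRows_table]
  exact solve_iff μ T ⟨A, hA⟩ ⟨B, hB⟩

theorem combinedComplexityInPolyTime (μ : MultiplicityCoding) :
    CombinedComplexityInPolyTime μ unaryPIAs := by
  have hitem {f : List Γ' → Data} (hf : PolyFun f) :
      PolyFun fun w => ((f w).toItems.headD .nil).toName :=
    .toName (.headD (.toItems hf) (.const _))
  -- The table yields two items, columns and rows; the two sides of the atom are the third and the
  -- fourth, each a list with a single name.
  have hF : PolyFun fun w => solve μ.cap
      (((parse w).tail.tail.headD .nil).toItems.headD .nil).toName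
      (((parse w).tail.tail.tail.headD .nil).toItems.headD .nil).toName
      (readCols ((parse w).headD .nil)) (readRows ((parse w).tail.headD .nil)) :=
    .solve μ (hitem (.headD (.tail (.tail .parse)) (.const _)))
      (hitem (.headD (.tail (.tail (.tail .parse))) (.const _)))
      (.readCols (.headD .parse (.const _)))
      (.readRows (.headD (.tail .parse) (.const _)))
  refine hF.inPolyTime ?_
  rintro ⟨⟨T, X, Y⟩, ⟨hX, hY⟩, hT⟩
  obtain ⟨A, rfl⟩ := Finset.card_eq_one.1 hX
  obtain ⟨B, rfl⟩ := Finset.card_eq_one.1 hY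
  have hA : A ∈ T.schema.attrs := hT.1 (Finset.mem_singleton_self A)
  have hB : B ∈ T.schema.attrs := hT.2 (Finset.mem_singleton_self B)
  have h : Parses (T.encode μ ++ PIA.encode ⟨{A}, {B}⟩) _ :=
    (Parses.table μ T).append ((Parses.list Parses.name _).append (Parses.list Parses.name _))
  simp only [h.parse_eq]
  simp only [List.cons_append, List.nil_append, List.headD_cons, List.tail_cons, readCols_table,
    readRows_table, Data.toItems_ofItems, Finset.sort_singleton, List.flatMap_cons,
    List.flatMap_nil, Data.toName_ofName]
  exact solve_iff μ T ⟨A, hA⟩ ⟨B, hB⟩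

end PossibleIndependence

theorem mainTheorem5 (μ : PossibleIndependence.MultiplicityCoding) :
    PossibleIndependence.DataComplexityInPolyTime μ PossibleIndependence.unaryPIAs ∧
      PossibleIndependence.CombinedComplexityInPolyTime μ PossibleIndependence.unaryPIAs :=
  ⟨PossibleIndependence.dataComplexityInPolyTime μ,
    PossibleIndependence.combinedComplexityInPolyTime μ⟩
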